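/- Let $\Omega\subset\mathbb R^2$ be a nonempty bounded open set and $\lambda,\nu>0$. Let $f:[0,1]\times\Omega\to\mathbb R$ be continuous and bounded below by an integrable function of $x$, i.e. $f(\gamma,x)\ge g(x)$ for some $g\in L^1(\Omega)$ (this is automatic if $f$ is continuous on $[0,1]\times\overline\Omega$). Let $\mu^0$ be a Borel probability measure on $[0,1]$, and let $c:[0,1]\times[0,1]\to\mathbb R$ be lower semicontinuous with $c(\gamma_1,\gamma_2)\ge a(\gamma_1)+b(\gamma_2)$ for all $\gamma_1,\gamma_2\in[0,1]$, where $a,b\in L^1([0,1])$ are upper semicontinuous. For $u:\Omega\to\mathbb R$ let $\mathrm{TV}(u)=\sup\{\int_\Omega u\,\mathrm{div}\,\xi\,dx:\ \xi\in C^1_c(\Omega,\mathbb R^2),\ \|\xi\|_\infty\le1\}$. Let $C'$ be the set of measurable functions $\phi:\Omega\times\mathbb R\to\{0,1\}$ (up to null sets) that have finite total variation in $\Omega\times\mathbb R$, satisfy $\phi=1$ a.e. on $\Omega\times(-\infty,0]$ and $\phi=0$ a.e. on $\Omega\times[1,\infty)$, and are nonincreasing in $\gamma$, i.e. $D_\gamma\phi\le0$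 in the sense of distributions. For $\phi\in C'$, $-D_\gamma\phi$ is a finite positive measure on $\Omega\times\mathbb R$; put $\mu^\phi(A)=\frac1{|\Omega|}(-D_\gamma\phi)(\Omega\times A)$ for Borel $A\subset[0,1]$. Let $D$ be the set of pairs $(\psi,\psi')$ of Borel functions $[0,1]\to\mathbb R$, integrable on $[0,1]$ with respect to Lebesgue measure, such that $\psi(\gamma_1)-\psi'(\gamma_2)\le c(\gamma_1,\gamma_2)$ for all $\gamma_1,\gamma_2\in[0,1]$. For $\phi\in C'$ and $(\psi,\psi')\in D$ let $$E'(\phi,\psi,\psi')=-\int_{\Omega\times[0,1]}f(\gamma,x)\,dD_\gamma\phi(x,\gamma)+\lambda\int_0^1\mathrm{TV}(\phi(\cdot,\gamma))\,d\gamma+\nu\Big(\int_0^1\psi\,d\mu^\phi-\int_0^1\psi'\,d\mu^0\Big)\in[-\infty,\infty],$$ where the integrals are taken in the extended sense $\int h^+-\int h^-$ and the last bracket is set to $-\infty$ (so that the pair does not contribute to the supremum below) whenever an expression $\infty-\infty$ occurs in it. Then there exists $\overline\phi\in C'$ with $$\sup_{(\psi,\psi')\in D}E'(\overline\phi,\psi,\psi')=\min_{\phi\in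 C'}\ \sup_{(\psi,\psi')\in D}E'(\phi,\psi,\psi').$$ -/

import Mathlib

open MeasureTheory Set

namespace LiftedWasserstein

/-- The plane, with its Euclidean norm. -/
abbrev Plane : Type := EuclideanSpace ℝ (Fin 2)

/-- `C¹` maps whose support is a compact subset of `U`. -/
structure IsTest {E F : Type*} [NormedAddCommGroup E] [NormedSpace ℝ E]
    [NormedAddCommGroup F] [NormedSpace ℝ F] (U : Set E) (w : E → F) : Prop where
  contDiff : ContDiff ℝ 1 w
  hasCompactSupport : HasCompactSupport w
  tsupport_subset : tsupport w ⊆ U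

/-- The divergence of a planar vector field. -/
noncomputable def div (ξ : Plane → Plane) (x : Plane) : ℝ :=
  ∑ i : Fin 2, (fderiv ℝ ξ x (EuclideanSpace.single i 1)) i

/-- The total variation of `u` in `Ω`:
`sup { ∫_Ω u div ξ : ξ ∈ C¹_c(Ω, ℝ²), ‖ξ‖_∞ ≤ 1 }`. The set of values is symmetric,
so cutting off the negative ones does not change the supremum. -/
noncomputable def TV (Ω : Set Plane) (u : Plane → ℝ) : ENNReal :=
  ⨆ (ξ : Plane → Plane) (_ : IsTest Ω ξ) (_ : ∀ x, ‖ξ x‖ ≤ 1),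
    ENNReal.ofReal (∫ x in Ω, u x * div ξ x)

/-- The divergence of the vector field `(ξ, η)` on `ℝ² × ℝ`. -/
noncomputable def liftedDiv (ξ : Plane × ℝ → Plane) (η : Plane × ℝ → ℝ) (p : Plane × ℝ) : ℝ :=
  div (fun y => ξ (y, p.2)) p.1 + deriv (fun t => η (p.1, t)) p.2

/-- The total variation of `φ` in `Ω × ℝ`; the fields `(ξ, η)` are bounded by `1` in the
Euclidean norm of `ℝ³`. -/
noncomputable def liftedTV (Ω : Set Plane) (φ : Plane × ℝ → ℝ) : ENNReal :=
  ⨆ (ξ : Plane × ℝ → Plane) (η : Plane × ℝ → ℝ)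
    (_ : IsTest (Ω ×ˢ (univ : Set ℝ)) ξ) (_ : IsTest (Ω ×ˢ (univ : Set ℝ)) η)
    (_ : ∀ p, ‖ξ p‖ ^ 2 + η p ^ 2 ≤ 1),
    ENNReal.ofReal (∫ p in Ω ×ˢ (univ : Set ℝ), φ p * liftedDiv ξ η p)

/-- The set `C'` of `{0,1}`-valued functions of bounded variation on `Ω × ℝ` that are `1` for
`γ ≤ 0`, `0` for `γ ≥ 1` and nonincreasing in `γ` in the sense of distributions. As usual for
`BV`, functions matter up to null sets. Such functions are not integrable over `Ω × (-∞, 0]`, so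
bounded variation means: locally integrable (automatic for measurable `{0,1}`-valued functions)
with finite total variation. -/
structure IsLifted (Ω : Set Plane) (φ : Plane × ℝ → ℝ) : Prop where
  aestronglyMeasurable : AEStronglyMeasurable φ (volume.restrict (Ω ×ˢ (univ : Set ℝ)))
  zero_or_one : ∀ᵐ p ∂(volume.restrict (Ω ×ˢ (univ : Set ℝ))), φ p = 0 ∨ φ p = 1
  finite_variation : liftedTV Ω φ < ⊤
  eq_one : ∀ᵐ p ∂(volume.restrict (Ω ×ˢ Iic (0 : ℝ))), φ p = 1
  eq_zero : ∀ᵐ p ∂(volume.restrict (Ω ×ˢ Ici (1 : ℝ))), φ p = 0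
  nonincreasing : ∀ w : Plane × ℝ → ℝ, IsTest (Ω ×ˢ (univ : Set ℝ)) w → (∀ p, 0 ≤ w p) →
    0 ≤ ∫ p in Ω ×ˢ (univ : Set ℝ), φ p * deriv (fun t => w (p.1, t)) p.2

/-- `m` is the finite Borel measure on `Ω × ℝ` that represents `-D_γ φ`:
`∫ φ ∂_γ w = ∫ w dm` for all test functions `w`. At most one measure does. -/
structure IsNegDerivGamma (Ω : Set Plane) (φ : Plane × ℝ → ℝ) (m : Measure (Plane × ℝ)) :
    Prop where
  finite : m univ < ⊤
  concentrated : m (Ω ×ˢ (univ : Set ℝ))ᶜ = 0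
  integral_eq : ∀ w : Plane × ℝ → ℝ, IsTest (Ω ×ˢ (univ : Set ℝ)) w →
    ∫ p in Ω ×ˢ (univ : Set ℝ), φ p * deriv (fun t => w (p.1, t)) p.2 = ∫ p, w p ∂m

open Classical in
/-- The measure `-D_γ φ` (it exists for every `φ` in `C'`; the value `0` elsewhere is not used). -/
noncomputable def negDerivGamma (Ω : Set Plane) (φ : Plane × ℝ → ℝ) : Measure (Plane × ℝ) :=
  if h : ∃ m, IsNegDerivGamma Ω φ m then h.choose else 0

/-- The histogram `μ^φ(A) = |Ω|⁻¹ (-D_γ φ)(Ω × A)`, `A ⊆ [0,1]`. -/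
noncomputable def histogram (Ω : Set Plane) (φ : Plane × ℝ → ℝ) : Measure ℝ :=
  (volume Ω)⁻¹ •
    ((negDerivGamma Ω φ).restrict (Ω ×ˢ Icc (0 : ℝ) 1)).map Prod.snd

/-- The integral `∫ g⁺ dμ - ∫ g⁻ dμ` in `[-∞, ∞]`, equal to `-∞` if both terms are infinite. -/
noncomputable def extIntegral {α : Type*} [MeasurableSpace α] (μ : Measure α) (g : α → ℝ) :
    EReal :=
  ((∫⁻ x, ENNReal.ofReal (g x) ∂μ : ENNReal) : EReal) -
    ((∫⁻ x, ENNReal.ofReal (-g x) ∂μ : ENNReal) : EReal)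

/-- The set `D` of dual potentials for the cost `c`: Borel functions, integrable on `[0,1]`. -/
def dualSet (c : ℝ → ℝ → ℝ) : Set ((ℝ → ℝ) × (ℝ → ℝ)) :=
  {p | Measurable p.1 ∧ Measurable p.2 ∧
    IntegrableOn p.1 (Icc 0 1) ∧ IntegrableOn p.2 (Icc 0 1) ∧
    ∀ γ₁ ∈ Icc (0 : ℝ) 1, ∀ γ₂ ∈ Icc (0 : ℝ) 1, p.1 γ₁ - p.2 γ₂ ≤ c γ₁ γ₂}

/-- The lifted energy `E'(φ, ψ, ψ')`. Potentials in `D` need not be integrable for `μ^φ` or `μ⁰`;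
`∫ ψ dμ^φ - ∫ ψ' dμ⁰` is written as `∫ ψ dμ^φ + ∫ (-ψ') dμ⁰` so that, since `⊤ + ⊥ = ⊥`
in `EReal`, a pair for which the expression is undefined gets the value `-∞` and does not
contribute to the supremum over `D`. -/
noncomputable def liftedEnergy (Ω : Set Plane) (f : ℝ → Plane → ℝ) (lam nu : ℝ) (μ₀ : Measure ℝ)
    (φ : Plane × ℝ → ℝ) (ψ ψ' : ℝ → ℝ) : EReal :=
  extIntegral ((negDerivGamma Ω φ).restrict (Ω ×ˢ Icc (0 : ℝ) 1)) (fun p => f p.2 p.1)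
    + (lam : EReal) * ((∫⁻ γ in Icc (0 : ℝ) 1, TV Ω (fun x => φ (x, γ)) : ENNReal) : EReal)
    + (nu : EReal) *
      (extIntegral (histogram Ω φ) ψ + extIntegral μ₀ (fun γ => -ψ' γ))

end LiftedWasserstein

/-! The direct method works once the lifted problem is written in terms of a function `u` on `Ω`.
Monotonicity in `γ` forces every element of `C'` to agree a.e. with the indicator of the region
below the graph of a measurable `u : Ω → [0,1]` (`IsLifted.exists_subgraph`). Then `-D_γ φ` is the
image of Lebesgue measure under `x ↦ (x, u x)`, the histogram is the normalised law of `u`, and the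
energy splits into a part `A u` in `[0, ∞]`, a real constant, and the transport term
(`liftedEnergy_eq`).

Along a minimising sequence, the bound on the integrated level-set variation bounds the variation of
`u` by a coarea-type inequality (`setIntegral_mul_div_le`). A Rellich-type argument then gives an
a.e. convergent subsequence (`exists_subseq_tendsto_ae`); only compact subsets of `Ω` enter the
variation estimates, so no boundary regularity is needed. The part `A` is lower semicontinuous by
Fatou's lemma, for the data term (`lintegral_sub_le_liminf`) and level by level for the variation
(`lintegral_TV_le_liminf`).

The transport term is the delicate one: the pairing with a merely Borel potential need not pass to
the limit. For a fixed continuous pair it converges, so the limit satisfies the wanted energy bound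
for all continuous pairs. Kantorovich duality extends it to all of `D` (`extIntegral_dual_le`): a
bound for continuous pairs produces a transport plan whose cost obeys the same bound, and
integrating `ψ(γ₁) - ψ'(γ₂) ≤ c(γ₁, γ₂)` against that plan controls every Borel pair, integrable or
not. -/

open Filter Topology CompactlySupported

namespace LiftedWasserstein

/-! ### Averages along segments: finite differences as derivatives of test functions -/

section SegAvg

variable {E : Type*} [NormedAddCommGroup E] [NormedSpace ℝ E]

/-- The average of `w` over the segment from `y - h` to `y`. -/
noncomputable def segAvg (h : E) (w : E → ℝ) (y : E) : ℝ := ∫ s in (0 : ℝ)..1, w (y - s • h)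

/-- The average is the convolution of `w` with a finite measure, the image of Lebesgue measure on
the unit interval under `s ↦ s • h`, so it inherits the smoothness of `w`. -/
lemma contDiff_segAvg [MeasurableSpace E] [BorelSpace E] {w : E → ℝ} (hw : ContDiff ℝ 1 w)
    (hc : HasCompactSupport w) (h : E) : ContDiff ℝ 1 (segAvg h w) := by
  let μ : Measure E := (volume.restrict (Ioc (0 : ℝ) 1)).map (fun s : ℝ => s • h)
  have hcont : Continuous (fun s : ℝ => s • h) := by fun_prop
  have : IsFiniteMeasure μ := Measure.isFiniteMeasure_map _ _
  have key : segAvg h w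
      = convolution (fun _ : E => (1 : ℝ)) w (ContinuousLinearMap.lsmul ℝ ℝ) μ := by
    ext y
    simp only [segAvg, convolution, ContinuousLinearMap.lsmul_apply, one_smul]
    rw [intervalIntegral.integral_of_le zero_le_one,
      integral_map hcont.aemeasurable]
    have : Continuous fun t : E => w (y - t) := hw.continuous.comp (by fun_prop)
    exact (this.stronglyMeasurable_of_hasCompactSupport
      (hc.comp_homeomorph (Homeomorph.subLeft y))).aestronglyMeasurable
  rw [key]
  exact hc.contDiff_convolution_right _ (locallyIntegrable_const 1) hw

/-- This turns a difference of translates into a derivative of an admissible test function.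
Distributional information on derivatives thereby becomes information on translates, without
mollifying the unknown function. -/
lemma fderiv_segAvg [MeasurableSpace E] [BorelSpace E] {w : E → ℝ} (hw : ContDiff ℝ 1 w)
    (hc : HasCompactSupport w) (h y : E) :
    fderiv ℝ (segAvg h w) y h = w y - w (y - h) := by
  have h1 : HasDerivAt (fun t : ℝ => segAvg h w (y + t • h)) (fderiv ℝ (segAvg h w) y h) 0 := by
    have hd : HasFDerivAt (segAvg h w) (fderiv ℝ (segAvg h w) (y + (0 : ℝ) • h))
        (y + (0 : ℝ) • h) :=
      ((contDiff_segAvg hw hc h).differentiable one_ne_zero _).hasFDerivAt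
    have hl : HasDerivAt (fun t : ℝ => y + t • h) h 0 := by
      simpa using ((hasDerivAt_id (0 : ℝ)).smul_const h).const_add y
    have := hd.comp_hasDerivAt (0 : ℝ) hl
    simp only [zero_smul, add_zero] at this
    exact this
  let k : ℝ → ℝ := fun r => w (y - r • h)
  have hk : Continuous k := hw.continuous.comp (by fun_prop)
  -- Substituting `r = s - t` moves the dependence on `t` into the endpoints, where the fundamental
  -- theorem of calculus applies.
  have h2 : ∀ t : ℝ, segAvg h w (y + t • h) = (∫ r in (0 : ℝ)..(1 - t), k r)
      - ∫ r in (0 : ℝ)..(0 - t), k r := by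
    intro t
    rw [intervalIntegral.integral_interval_sub_left (hk.intervalIntegrable _ _)
      (hk.intervalIntegrable _ _), ← intervalIntegral.integral_comp_sub_right k t]
    refine intervalIntegral.integral_congr fun s _ => ?_
    simp only [k]
    congr 1
    module
  have hF : ∀ b, HasDerivAt (fun x => ∫ r in (0 : ℝ)..x, k r) (k b) b := fun b =>
    intervalIntegral.integral_hasDerivAt_right (hk.intervalIntegrable _ _)
      (hk.stronglyMeasurableAtFilter _ _) hk.continuousAt
  have h3 : ∀ b : ℝ, HasDerivAt (fun t : ℝ => ∫ r in (0 : ℝ)..(b - t), k r) (-k b) 0 := by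
    intro b
    have := HasDerivAt.comp (0 : ℝ) (h₂ := fun x => ∫ r in (0 : ℝ)..x, k r) (h := fun t => b - t)
      (hF (b - 0)) ((hasDerivAt_id (0 : ℝ)).const_sub b)
    simpa [Function.comp_def] using this
  have h4 := (h3 1).sub (h3 0)
  have h5 := h1.unique (h4.congr_of_eventuallyEq (Eventually.of_forall h2))
  rw [h5]
  simp [k]
  ring

lemma tsupport_segAvg_subset {w : E → ℝ} (hc : HasCompactSupport w) (h : E) :
    tsupport (segAvg h w) ⊆ (fun q : ℝ × E => q.2 + q.1 • h) '' (Icc (0 : ℝ) 1 ×ˢ tsupport w) := by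
  have hcl : IsClosed ((fun q : ℝ × E => q.2 + q.1 • h) '' (Icc (0 : ℝ) 1 ×ˢ tsupport w)) :=
    ((isCompact_Icc.prod hc).image (by fun_prop)).isClosed
  refine closure_minimal (fun y hy => ?_) hcl
  by_contra hcon
  apply hy
  simp only [segAvg]
  rw [intervalIntegral.integral_congr (g := fun _ => 0)]
  · simp
  · intro s hs
    rw [uIcc_of_le zero_le_one] at hs
    by_contra hne
    exact hcon ⟨(s, y - s • h), ⟨hs, subset_tsupport _ hne⟩, by simp⟩

lemma hasCompactSupport_segAvg {w : E → ℝ} (hc : HasCompactSupport w) (h : E) :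
    HasCompactSupport (segAvg h w) :=
  ((isCompact_Icc.prod hc).image (f := fun q : ℝ × E => q.2 + q.1 • h) (by fun_prop)).of_isClosed_subset
    (isClosed_tsupport _) (tsupport_segAvg_subset hc h)

lemma abs_segAvg_le {w : E → ℝ} (hw : ∀ x, |w x| ≤ 1) (h y : E) : |segAvg h w y| ≤ 1 := by
  have := intervalIntegral.norm_integral_le_of_norm_le_const (a := (0 : ℝ)) (b := 1) (C := 1)
    (f := fun s => w (y - s • h)) (fun s _ => hw _)
  simpa [segAvg] using this

lemma segAvg_nonneg {w : E → ℝ} (hw : ∀ x, 0 ≤ w x) (h y : E) : 0 ≤ segAvg h w y :=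
  intervalIntegral.integral_nonneg zero_le_one fun _ _ => hw _

end SegAvg

/-! ### Approximation of bounded measurable functions by test functions -/

section Mollify

variable {E : Type*} [NormedAddCommGroup E] [NormedSpace ℝ E] [FiniteDimensional ℝ E]
  [MeasurableSpace E] [BorelSpace E]

/-- Mollification at scales `δ / (n + 2)` keeps bounds and signs and enlarges the support by less
than `δ`. Convergence a.e. is Lebesgue differentiation, which needs the outer and inner radii of the
bumps to stay comparable; here their ratio is `2`. -/
lemma exists_smooth_approx (μ : Measure E) [μ.IsAddHaarMeasure] {K : Set E}
    {δ : ℝ} (hδ : 0 < δ) {s : E → ℝ} (hs : Measurable s) (hs1 : ∀ x, |s x| ≤ 1)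
    (hsK : ∀ x, x ∉ K → s x = 0) :
    ∃ w : ℕ → E → ℝ, (∀ n, ContDiff ℝ 1 (w n)) ∧ (∀ n, tsupport (w n) ⊆ Metric.cthickening δ K) ∧
      (∀ n x, |w n x| ≤ 1) ∧ ((∀ x, 0 ≤ s x) → ∀ n x, 0 ≤ w n x) ∧
      ∀ᵐ x ∂μ, Tendsto (fun n => w n x) atTop (𝓝 (s x)) := by
  have hpos : ∀ n : ℕ, 0 < δ / (n + 2 : ℝ) := fun n => by positivity
  let φ : ℕ → ContDiffBump (0 : E) := fun n =>
    ⟨δ / (n + 2 : ℝ) / 2, δ / (n + 2 : ℝ), half_pos (hpos n), half_lt_self (hpos n)⟩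
  have hsloc : LocallyIntegrable s μ := by
    have : LocallyIntegrable (fun _ : E => (1 : ℝ)) μ := locallyIntegrable_const 1
    refine this.mono hs.aestronglyMeasurable (Eventually.of_forall fun x => ?_)
    simpa using hs1 x
  refine ⟨fun n => convolution ((φ n).normed μ) s (ContinuousLinearMap.lsmul ℝ ℝ) μ,
    fun n => ?_, fun n => ?_, fun n x => ?_, fun h0 n x => ?_, ?_⟩
  · exact ((φ n).hasCompactSupport_normed).contDiff_convolution_left _ (φ n).contDiff_normed hsloc
  · refine closure_minimal (fun y hy => ?_) Metric.isClosed_cthickening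
    have := support_convolution_subset_swap (ContinuousLinearMap.lsmul ℝ ℝ : ℝ →L[ℝ] ℝ →L[ℝ] ℝ) hy
    obtain ⟨a, ha, b, hb, rfl⟩ := this
    have ha' : a ∈ K := by
      by_contra h; exact ha (hsK a h)
    rw [(φ n).support_normed_eq] at hb
    refine Metric.mem_cthickening_of_dist_le _ a δ K ha' ?_
    have : ‖b‖ < δ / (n + 2 : ℝ) := by simpa using hb
    have h2 : δ / (n + 2 : ℝ) ≤ δ := div_le_self hδ.le (by linarith [(n.cast_nonneg : (0 : ℝ) ≤ n)])
    simp only [dist_eq_norm, add_sub_cancel_left]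
    linarith
  · simp only [convolution, ContinuousLinearMap.lsmul_apply, smul_eq_mul]
    calc |∫ t, (φ n).normed μ t * s (x - t) ∂μ| ≤ ∫ t, (φ n).normed μ t ∂μ := by
          rw [← Real.norm_eq_abs]
          refine norm_integral_le_of_norm_le ((φ n).integrable_normed (μ := μ))
            (Eventually.of_forall fun t => ?_)
          rw [norm_mul, Real.norm_of_nonneg ((φ n).nonneg_normed t)]
          exact mul_le_of_le_one_right ((φ n).nonneg_normed t) (hs1 _)
      _ = 1 := (φ n).integral_normed
  · exact integral_nonneg fun t => by
      simpa using mul_nonneg ((φ n).nonneg_normed (μ := μ) t) (h0 (x - t))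
  · refine ContDiffBump.ae_convolution_tendsto_right_of_locallyIntegrable (K := 2) ?_ ?_ hsloc
    · change Tendsto (fun n : ℕ => δ / (n + 2 : ℝ)) atTop (𝓝 0)
      exact tendsto_const_nhds.div_atTop
        (tendsto_atTop_add_const_right _ _ tendsto_natCast_atTop_atTop)
    · refine Eventually.of_forall fun n => ?_
      change δ / (n + 2 : ℝ) ≤ 2 * (δ / (n + 2 : ℝ) / 2)
      linarith

end Mollify

/-! ### Lifted functions are indicators of subgraphs -/

instance : (volume : Measure (Plane × ℝ)).IsAddHaarMeasure :=
  Measure.prod.instIsAddHaarMeasure volume volume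

lemma deriv_snd_eq_fderiv {w : Plane × ℝ → ℝ} (hw : Differentiable ℝ w) (p : Plane × ℝ) :
    deriv (fun t => w (p.1, t)) p.2 = fderiv ℝ w p (0, 1) := by
  have h1 : HasFDerivAt w (fderiv ℝ w p) (p.1, p.2) := (hw p).hasFDerivAt
  have h2 : HasDerivAt (fun t : ℝ => (p.1, t)) ((0 : Plane), (1 : ℝ)) p.2 :=
    (hasDerivAt_const p.2 p.1).prodMk (hasDerivAt_id p.2)
  exact (h1.comp_hasDerivAt p.2 h2).deriv

lemma IsLifted.exists_measurableSet {Ω : Set Plane} {φ : Plane × ℝ → ℝ} (hφ : IsLifted Ω φ) :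
    ∃ E : Set (Plane × ℝ), MeasurableSet E ∧
      φ =ᵐ[volume.restrict (Ω ×ˢ (univ : Set ℝ))] E.indicator 1 := by
  have hm := hφ.aestronglyMeasurable
  refine ⟨hm.mk φ ⁻¹' {1}, hm.stronglyMeasurable_mk.measurable (measurableSet_singleton 1), ?_⟩
  filter_upwards [hm.ae_eq_mk, hφ.zero_or_one] with p h1 h2
  by_cases h : hm.mk φ p = 1
  · rw [indicator_of_mem (by simpa using h), h1, h]; rfl
  · rw [indicator_of_notMem (by simpa using h)]
    exact h2.resolve_right (h1 ▸ h)

/-- If the exceptional set had positive measure it would contain a compact `K` of positive measure.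
Testing monotonicity with vertical averages of mollified indicators of `K` gives, in the limit, a
nonnegative integral over `K` of `1_E(p) - 1_E(p + e)`, whose integrand is `-1` there. -/
lemma ae_mem_of_add_mem {Ω : Set Plane} (hΩ : IsOpen Ω) {E : Set (Plane × ℝ)}
    (hE : MeasurableSet E)
    (hmono : ∀ w : Plane × ℝ → ℝ, IsTest (Ω ×ˢ (univ : Set ℝ)) w → (∀ p, 0 ≤ w p) →
      0 ≤ ∫ p in Ω ×ˢ (univ : Set ℝ), E.indicator 1 p * deriv (fun t => w (p.1, t)) p.2)
    {h : ℝ} (hh : 0 < h) :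
    ∀ᵐ p : Plane × ℝ, p.1 ∈ Ω → p + (0, h) ∈ E → p ∈ E := by
  set e : Plane × ℝ := (0, h) with he
  have hU : IsOpen (Ω ×ˢ (univ : Set ℝ)) := hΩ.prod isOpen_univ
  let g : Plane × ℝ → ℝ := E.indicator 1
  have hg : Measurable g := measurable_one.indicator hE
  have hg1 : ∀ p, |g p| ≤ 1 := fun p => by
    by_cases hp : p ∈ E <;> simp [g, hp]
  let N : Set (Plane × ℝ) := (Ω ×ˢ univ) ∩ ({p | p + e ∈ E} ∩ Eᶜ)
  have hN : MeasurableSet N :=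
    hU.measurableSet.inter (((measurable_add_const e) hE).inter hE.compl)
  suffices hN0 : volume N = 0 by
    filter_upwards [measure_eq_zero_iff_ae_notMem.1 hN0] with p hp h1 h2
    by_contra h3
    exact hp ⟨⟨h1, mem_univ _⟩, h2, h3⟩
  by_contra hne
  obtain ⟨K, hKN, hK, hKpos⟩ := hN.exists_lt_isCompact (pos_iff_ne_zero.2 hne)
  obtain ⟨δ, hδ, hδU⟩ := hK.exists_cthickening_subset_open hU (hKN.trans inter_subset_left)
  have hKm := hK.measurableSet
  obtain ⟨w, hwC, hws, hw1, hw0, hwlim⟩ := exists_smooth_approx (volume : Measure (Plane × ℝ)) hδ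
   
    (s := K.indicator 1) (measurable_one.indicator hKm)
    (fun p => by by_cases hp : p ∈ K <;> simp [hp]) (fun p hp => indicator_of_notMem hp _)
  have hC : IsCompact (Metric.cthickening δ K) := hK.cthickening
  have hwc : ∀ n, HasCompactSupport (w n) := fun n =>
    hC.of_isClosed_subset (isClosed_tsupport _) (hws n)
  have hw0' : ∀ n p, 0 ≤ w n p := hw0 fun p => indicator_nonneg (fun _ _ => zero_le_one) p
  have hwi : ∀ n, Integrable (w n) := fun n =>
    (hwC n).continuous.integrable_of_hasCompactSupport (hwc n)
  have hkey : ∀ n, 0 ≤ ∫ p, (g p - g (p + e)) * w n p := by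
    intro n
    have hD : Differentiable ℝ (segAvg e (w n)) :=
      (contDiff_segAvg (hwC n) (hwc n) e).differentiable one_ne_zero
    have hder : ∀ p : Plane × ℝ, deriv (fun t => segAvg e (w n) (p.1, t)) p.2
        = h⁻¹ * (w n p - w n (p - e)) := by
      intro p
      rw [deriv_snd_eq_fderiv hD, ← fderiv_segAvg (hwC n) (hwc n)]
      have : e = h • ((0 : Plane), (1 : ℝ)) := by simp [he]
      rw [congrArg (fderiv ℝ (segAvg e (w n)) p) this, map_smul, smul_eq_mul,
        inv_mul_cancel_left₀ hh.ne']
    have h1 := hmono (segAvg e (w n))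
      ⟨contDiff_segAvg (hwC n) (hwc n) e, hasCompactSupport_segAvg (hwc n) e, ?_⟩
      (segAvg_nonneg (hw0' n) e)
    swap
    -- The shift is vertical, so it cannot leave the cylinder over `Ω`, whatever the size of `h`.
    · refine (tsupport_segAvg_subset (hwc n) e).trans ?_
      rintro _ ⟨⟨a, q⟩, ⟨-, hq⟩, rfl⟩
      have := (hδU (hws n hq)).1
      simpa [he] using this
    rw [setIntegral_eq_integral_of_forall_compl_eq_zero] at h1
    swap
    · intro p hp
      have h0 : ∀ q : Plane × ℝ, q.1 ∉ Ω → w n q = 0 := fun q hq => by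
        by_contra hc
        exact hq (hδU (hws n (subset_tsupport _ hc))).1
      have hp' : p.1 ∉ Ω := fun hc => hp ⟨hc, mem_univ _⟩
      rw [hder, h0 p hp', h0 (p - e) (by simpa [he] using hp')]
      simp
    have hi1 : Integrable fun p => g p * w n p :=
      (hwi n).bdd_mul hg.aestronglyMeasurable (Eventually.of_forall hg1)
    have hi2 : Integrable fun p => g p * w n (p - e) :=
      ((hwi n).comp_sub_right e).bdd_mul hg.aestronglyMeasurable (Eventually.of_forall hg1)
    have hi3 : Integrable fun p => g (p + e) * w n p :=
      (hwi n).bdd_mul (hg.comp (measurable_add_const e)).aestronglyMeasurable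
        (Eventually.of_forall fun p => hg1 _)
    have h2 : ∫ p, g p * w n (p - e) = ∫ p, g (p + e) * w n p := by
      rw [← integral_add_right_eq_self _ e]
      simp
    have h3 : ∫ p, E.indicator 1 p * deriv (fun t => segAvg e (w n) (p.1, t)) p.2
        = h⁻¹ * ∫ p, (g p - g (p + e)) * w n p := by
      calc _ = ∫ p, h⁻¹ * (g p * w n p - g p * w n (p - e)) := by
            refine integral_congr_ae (Eventually.of_forall fun p => ?_)
            simp only [hder]
            change g p * _ = _
            ring
        _ = h⁻¹ * ((∫ p, g p * w n p) - ∫ p, g p * w n (p - e)) := by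
            rw [integral_const_mul, integral_sub hi1 hi2]
        _ = _ := by
            rw [h2, ← integral_sub hi1 hi3]
            simp only [sub_mul]
    rw [h3] at h1
    exact (mul_nonneg_iff_of_pos_left (inv_pos.2 hh)).1 h1
  have hlim : Tendsto (fun n => ∫ p, (g p - g (p + e)) * w n p) atTop
      (𝓝 (∫ p, (g p - g (p + e)) * K.indicator 1 p)) := by
    refine tendsto_integral_of_dominated_convergence
      (fun p => 2 * (Metric.cthickening δ K).indicator 1 p) (fun n => ?_) ?_ (fun n => ?_) ?_
    · exact ((hg.sub (hg.comp (measurable_add_const e))).mul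
        (hwC n).continuous.measurable).aestronglyMeasurable
    · refine Integrable.const_mul ?_ 2
      exact (integrable_indicator_iff hC.measurableSet).2
        (integrableOn_const (C := (1 : ℝ)) (hs := hC.measure_lt_top.ne))
    · refine Eventually.of_forall fun p => ?_
      rw [norm_mul]
      have hb : ‖g p - g (p + e)‖ ≤ 2 := by
        have := norm_sub_le (g p) (g (p + e))
        have h1 := hg1 p
        have h2 := hg1 (p + e)
        simp only [Real.norm_eq_abs] at *
        linarith
      refine mul_le_mul hb ?_ (norm_nonneg _) two_pos.le
      by_cases hp : p ∈ Metric.cthickening δ K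
      · simpa [hp] using hw1 n p
      · have : w n p = 0 := by
          by_contra hc
          exact hp (hws n (subset_tsupport _ hc))
        simp [this, hp]
    · filter_upwards [hwlim] with p hp
      exact hp.const_mul _
  have hle := ge_of_tendsto' hlim hkey
  have hval : ∫ p, (g p - g (p + e)) * K.indicator 1 p = - volume.real K := by
    have : ∀ p, (g p - g (p + e)) * K.indicator 1 p = K.indicator (fun _ => (-1 : ℝ)) p := by
      intro p
      by_cases hp : p ∈ K
      · obtain ⟨-, h1, h2⟩ := hKN hp
        have h1' : p + e ∈ E := h1
        have h2' : p ∉ E := h2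
        simp [g, hp, h1', h2']
      · simp [hp]
    simp_rw [this]
    rw [integral_indicator_const _ hKm]
    simp
  rw [hval] at hle
  have : 0 < volume.real K := ENNReal.toReal_pos hKpos.ne' hK.measure_lt_top.ne
  linarith

/-- The indicator function of the region below the graph of `u`. -/
noncomputable def subgraphFn (u : Plane → ℝ) (p : Plane × ℝ) : ℝ :=
  {q : Plane × ℝ | q.2 < u q.1}.indicator 1 p

lemma measurableSet_subgraph {u : Plane → ℝ} (hu : Measurable u) :
    MeasurableSet {q : Plane × ℝ | q.2 < u q.1} :=
  measurableSet_lt measurable_snd (hu.comp measurable_fst)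

/-- The height `u x` is the length of the section of `E` over `x` inside `[0,1]`. Below a typical
point of `E` almost the whole vertical line lies in `E`, so its height is at most `u x`; above a
typical point outside `E` almost nothing does, so its height is at least `u x`. Equality occurs only
on the graph of `u`, a null set. -/
lemma IsLifted.exists_subgraph {Ω : Set Plane} (hΩ : IsOpen Ω) {φ : Plane × ℝ → ℝ}
    (hφ : IsLifted Ω φ) :
    ∃ u : Plane → ℝ, Measurable u ∧ (∀ x, u x ∈ Icc (0 : ℝ) 1) ∧
      φ =ᵐ[volume.restrict (Ω ×ˢ (univ : Set ℝ))] subgraphFn u := by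
  obtain ⟨E, hE, hφE⟩ := hφ.exists_measurableSet
  have hUm : MeasurableSet (Ω ×ˢ (univ : Set ℝ)) := hΩ.measurableSet.prod MeasurableSet.univ
  have hφE' : ∀ᵐ p : Plane × ℝ, p.1 ∈ Ω → φ p = E.indicator 1 p := by
    filter_upwards [(ae_restrict_iff' hUm).1 hφE] with p hp h1
    exact hp ⟨h1, mem_univ _⟩
  have A1 : ∀ h : ℝ, 0 < h → ∀ᵐ p : Plane × ℝ, p.1 ∈ Ω → p + (0, h) ∈ E → p ∈ E := by
    intro h hh
    refine ae_mem_of_add_mem hΩ hE (fun w hw hw0 => ?_) hh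
    refine (hφ.nonincreasing w hw hw0).trans_eq (integral_congr_ae ?_)
    filter_upwards [hφE] with p hp
    rw [hp]
  have A3 : ∀ h : ℝ, 0 < h → ∀ᵐ p : Plane × ℝ, p.1 ∈ Ω → p ∈ E → p - (0, h) ∈ E := by
    intro h hh
    have := (measurePreserving_sub_right (volume : Measure (Plane × ℝ))
      ((0 : Plane), h)).quasiMeasurePreserving.ae (A1 h hh)
    filter_upwards [this] with p hp h1 h2
    exact hp (by simpa using h1) (by simpa using h2)
  have hadd : Measurable fun q : (Plane × ℝ) × ℝ => q.1 + ((0 : Plane), q.2) := by fun_prop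
  have hsub : Measurable fun q : (Plane × ℝ) × ℝ => q.1 - ((0 : Plane), q.2) := by fun_prop
  -- Fubini exchanges the quantifiers: instead of an exceptional set for each shift, one null set of
  -- points, outside which almost every shift is allowed.
  have A2 : ∀ᵐ p : Plane × ℝ, ∀ᵐ h : ℝ, 0 < h → p.1 ∈ Ω → p + (0, h) ∈ E → p ∈ E := by
    rw [Measure.ae_ae_comm]
    · refine Eventually.of_forall fun h => ?_
      by_cases hh : 0 < h
      · filter_upwards [A1 h hh] with p hp _ using hp
      · exact Eventually.of_forall fun p h' => (hh h').elim
    · refine (measurableSet_lt measurable_const measurable_snd).imp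
        (MeasurableSet.imp ?_ (MeasurableSet.imp (hadd hE) (measurable_fst hE)))
      exact (measurable_fst.comp measurable_fst) hΩ.measurableSet
  have A4 : ∀ᵐ p : Plane × ℝ, ∀ᵐ h : ℝ, 0 < h → p.1 ∈ Ω → p ∈ E → p - (0, h) ∈ E := by
    rw [Measure.ae_ae_comm]
    · refine Eventually.of_forall fun h => ?_
      by_cases hh : 0 < h
      · filter_upwards [A3 h hh] with p hp _ using hp
      · exact Eventually.of_forall fun p h' => (hh h').elim
    · refine (measurableSet_lt measurable_const measurable_snd).imp
        (MeasurableSet.imp ?_ (MeasurableSet.imp (measurable_fst hE) (hsub hE)))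
      exact (measurable_fst.comp measurable_fst) hΩ.measurableSet
  have B1 : ∀ᵐ p : Plane × ℝ, p.1 ∈ Ω → p.2 ≤ 0 → φ p = 1 := by
    filter_upwards [(ae_restrict_iff' (hΩ.measurableSet.prod measurableSet_Iic)).1 hφ.eq_one]
      with p hp h1 h2 using hp ⟨h1, h2⟩
  have B2 : ∀ᵐ p : Plane × ℝ, p.1 ∈ Ω → 1 ≤ p.2 → φ p = 0 := by
    filter_upwards [(ae_restrict_iff' (hΩ.measurableSet.prod measurableSet_Ici)).1 hφ.eq_zero]
      with p hp h1 h2 using hp ⟨h1, h2⟩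
  let ρ : Measure ℝ := volume.restrict (Icc (0 : ℝ) 1)
  have hρ : ρ univ = 1 := by simp [ρ]
  have : IsProbabilityMeasure ρ := ⟨hρ⟩
  let u : Plane → ℝ := fun x => (ρ (Prod.mk x ⁻¹' E)).toReal
  have hu : Measurable u := (measurable_measure_prodMk_left hE).ennreal_toReal
  have hu01 : ∀ x, u x ∈ Icc (0 : ℝ) 1 := fun x =>
    ⟨ENNReal.toReal_nonneg, ENNReal.toReal_le_of_le_ofReal zero_le_one (by simpa using prob_le_one)⟩
  -- Both the graph of `u` and a horizontal plane are null. The plane `c = 0` is discarded because a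
  -- point at height `0` is not strictly below the graph where `u` vanishes.
  have hgraph : ∀ c : ℝ, ∀ᵐ p : Plane × ℝ, p.2 ≠ u p.1 ∧ p.2 ≠ c := by
    intro c
    refine (Measure.ae_prod_iff_ae_ae (μ := (volume : Measure Plane)) (ν := (volume : Measure ℝ))
      ?_).2 (Eventually.of_forall fun x => ?_)
    · exact (measurableSet_eq_fun measurable_snd (hu.comp measurable_fst)).compl.inter
        (measurable_snd (measurableSet_singleton c)).compl
    · filter_upwards [compl_mem_ae_iff.2 (measure_singleton (μ := (volume : Measure ℝ)) (u x)),
        compl_mem_ae_iff.2 (measure_singleton (μ := (volume : Measure ℝ)) c)] with t h1 h2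
      exact ⟨h1, h2⟩
  refine ⟨u, hu, hu01, (ae_restrict_iff' hUm).2 ?_⟩
  filter_upwards [hφE', A2, A4, B1, B2, hgraph 0] with p h1 h2 h4 h5 h6 h7 hpU
  have hp : p.1 ∈ Ω := hpU.1
  rcases le_or_gt p.2 0 with hp0 | hp0
  · have : p.2 < u p.1 := (lt_of_le_of_ne hp0 h7.2).trans_le (hu01 _).1
    rw [h5 hp hp0, subgraphFn, indicator_of_mem (by exact this)]; rfl
  rcases le_or_gt 1 p.2 with hp1 | hp1
  · have : ¬ p.2 < u p.1 := not_lt.2 ((hu01 _).2.trans hp1)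
    rw [h6 hp hp1, subgraphFn, indicator_of_notMem (by exact this)]
  rw [h1 hp]
  by_cases hpE : p ∈ E
  · have hae : ∀ᵐ t : ℝ, t < p.2 → (p.1, t) ∈ E := by
      filter_upwards [(Measure.measurePreserving_sub_left (volume : Measure ℝ)
        p.2).quasiMeasurePreserving.ae h4] with t ht htp
      have := ht (sub_pos.2 htp) hp hpE
      have he : p - (0, p.2 - t) = (p.1, t) := by ext <;> simp
      rwa [he] at this
    have hle : p.2 ≤ u p.1 := by
      have hm : ENNReal.ofReal p.2 ≤ ρ (Prod.mk p.1 ⁻¹' E) := by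
        calc ENNReal.ofReal p.2 = volume (Ioo 0 p.2) := by simp
          _ = ρ (Ioo 0 p.2) := by
            rw [Measure.restrict_apply measurableSet_Ioo, inter_eq_left.2]
            exact fun t ht => ⟨ht.1.le, (ht.2.trans hp1).le⟩
          _ ≤ ρ (Prod.mk p.1 ⁻¹' E) := by
            refine measure_mono_ae ?_
            filter_upwards [ae_restrict_of_ae hae] with t ht h0 using ht h0.2
      exact (ENNReal.ofReal_le_iff_le_toReal (measure_ne_top _ _)).1 hm
    have : p.2 < u p.1 := lt_of_le_of_ne hle h7.1
    rw [subgraphFn, indicator_of_mem hpE, indicator_of_mem (by exact this)]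
  · have hae : ∀ᵐ t : ℝ, p.2 < t → (p.1, t) ∉ E := by
      filter_upwards [(measurePreserving_sub_right (volume : Measure ℝ)
        p.2).quasiMeasurePreserving.ae h2] with t ht htp hc
      refine hpE (ht (sub_pos.2 htp) hp ?_)
      have he : p + (0, t - p.2) = (p.1, t) := by ext <;> simp
      rwa [he]
    have hle : u p.1 ≤ p.2 := by
      refine ENNReal.toReal_le_of_le_ofReal hp0.le ?_
      calc ρ (Prod.mk p.1 ⁻¹' E) ≤ ρ (Iic p.2) := by
            refine measure_mono_ae ?_
            filter_upwards [ae_restrict_of_ae hae] with t ht h0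
            exact not_lt.1 fun hc => ht hc h0
        _ ≤ volume (Icc 0 p.2) := by
            rw [Measure.restrict_apply measurableSet_Iic]
            exact measure_mono fun t ht => ⟨ht.2.1, ht.1⟩
        _ = ENNReal.ofReal p.2 := by simp
    rw [subgraphFn, indicator_of_notMem hpE, indicator_of_notMem (by exact not_lt.2 hle)]

/-! ### The vertical derivative of a subgraph -/

/-- Both measures have densities with respect to their sum. The difference of the densities is
orthogonal to all smooth test functions in the open cylinder, hence vanishes there, and neither
measure charges the complement. Uniqueness is what identifies the measure chosen in `negDerivGamma`.
-/
lemma IsNegDerivGamma.unique {Ω : Set Plane} (hΩ : IsOpen Ω) {φ : Plane × ℝ → ℝ}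
    {m₁ m₂ : Measure (Plane × ℝ)} (h₁ : IsNegDerivGamma Ω φ m₁) (h₂ : IsNegDerivGamma Ω φ m₂) :
    m₁ = m₂ := by
  have : IsFiniteMeasure m₁ := ⟨h₁.finite⟩
  have : IsFiniteMeasure m₂ := ⟨h₂.finite⟩
  set μ := m₁ + m₂ with hμ
  have : IsFiniteMeasure μ := by rw [hμ]; infer_instance
  have : m₁.HaveLebesgueDecomposition μ := Measure.haveLebesgueDecomposition_of_sigmaFinite m₁ μ
  have : m₂.HaveLebesgueDecomposition μ := Measure.haveLebesgueDecomposition_of_sigmaFinite m₂ μ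
  have hac₁ : m₁ ≪ μ := Measure.AbsolutelyContinuous.rfl.add_right m₂
  have hac₂ : m₂ ≪ μ := by
    rw [hμ, add_comm]; exact Measure.AbsolutelyContinuous.rfl.add_right m₁
  have hU : IsOpen (Ω ×ˢ (univ : Set ℝ)) := hΩ.prod isOpen_univ
  let d : Plane × ℝ → ℝ := fun p => (m₁.rnDeriv μ p).toReal - (m₂.rnDeriv μ p).toReal
  have hi₁ : Integrable (fun p => (m₁.rnDeriv μ p).toReal) μ := Measure.integrable_toReal_rnDeriv
  have hi₂ : Integrable (fun p => (m₂.rnDeriv μ p).toReal) μ := Measure.integrable_toReal_rnDeriv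
  have hzero : ∀ᵐ p ∂μ, p ∈ Ω ×ˢ (univ : Set ℝ) → d p = 0 := by
    refine hU.ae_eq_zero_of_integral_contDiff_smul_eq_zero
      ((hi₁.sub hi₂).locallyIntegrable.locallyIntegrableOn _) fun w hw hwc hws => ?_
    have ht : IsTest (Ω ×ˢ (univ : Set ℝ)) w := ⟨hw.of_le (by simp), hwc, hws⟩
    obtain ⟨C, hC⟩ := hw.continuous.bounded_above_of_compact_support hwc
    have hj : ∀ {k : Plane × ℝ → ℝ}, Integrable k μ → Integrable (fun p => k p * w p) μ :=
      fun hk => hk.mul_bdd hw.continuous.aestronglyMeasurable (Eventually.of_forall hC)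
    have e1 := integral_rnDeriv_smul hac₁ (f := w)
    have e2 := integral_rnDeriv_smul hac₂ (f := w)
    have e3 := (h₁.integral_eq w ht).symm.trans (h₂.integral_eq w ht)
    calc ∫ p, w p • d p ∂μ
        = ∫ p, ((m₁.rnDeriv μ p).toReal * w p - (m₂.rnDeriv μ p).toReal * w p) ∂μ := by
          refine integral_congr_ae (Eventually.of_forall fun p => ?_)
          simp only [d, smul_eq_mul]
          ring
      _ = 0 := by
          rw [integral_sub (hj hi₁) (hj hi₂)]
          simp only [smul_eq_mul] at e1 e2
          rw [e1, e2, e3, sub_self]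
  have hconc : ∀ᵐ p ∂μ, p ∈ Ω ×ˢ (univ : Set ℝ) := by
    rw [ae_iff]
    change μ (Ω ×ˢ (univ : Set ℝ))ᶜ = 0
    rw [hμ, Measure.add_apply, h₁.concentrated, h₂.concentrated, add_zero]
  have heq : m₁.rnDeriv μ =ᵐ[μ] m₂.rnDeriv μ := by
    filter_upwards [hzero, hconc, Measure.rnDeriv_lt_top m₁ μ, Measure.rnDeriv_lt_top m₂ μ]
      with p hp hpU hf1 hf2
    exact (ENNReal.toReal_eq_toReal_iff' hf1.ne hf2.ne).1 (sub_eq_zero.1 (hp hpU))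
  rw [← Measure.withDensity_rnDeriv_eq _ _ hac₁, ← Measure.withDensity_rnDeriv_eq _ _ hac₂,
    withDensity_congr_ae heq]

/-- The image of Lebesgue measure on `Ω` under `x ↦ (x, u x)`. -/
noncomputable def graphMeasure (Ω : Set Plane) (u : Plane → ℝ) : Measure (Plane × ℝ) :=
  (volume.restrict Ω).map fun x => (x, u x)

lemma hasCompactSupport_snd {F : Type*} [Zero F] {w : Plane × ℝ → F}
    (hc : HasCompactSupport w) (x : Plane) : HasCompactSupport fun t => w (x, t) := by
  refine HasCompactSupport.intro (hc.isCompact.image continuous_snd) fun t ht => ?_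
  by_contra h
  exact ht ⟨(x, t), subset_tsupport _ h, rfl⟩

lemma integrable_deriv_snd {U : Set (Plane × ℝ)} {w : Plane × ℝ → ℝ} (hw : IsTest U w) :
    Integrable fun p : Plane × ℝ => deriv (fun t => w (p.1, t)) p.2 := by
  simp_rw [deriv_snd_eq_fderiv (hw.contDiff.differentiable one_ne_zero)]
  have hcont : Continuous fun p => fderiv ℝ w p ((0 : Plane), (1 : ℝ)) :=
    (hw.contDiff.continuous_fderiv one_ne_zero).clm_apply continuous_const
  exact hcont.integrable_of_hasCompactSupport
    ((hw.hasCompactSupport.fderiv ℝ).comp_left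
      (g := fun L : Plane × ℝ →L[ℝ] ℝ => L ((0 : Plane), (1 : ℝ))) (by simp))

/-- By Fubini, each vertical line contributes the integral of `∂_t w(x, t)` over `t < u x`, which is
`w (x, u x)` because `w` has compact support. -/
lemma isNegDerivGamma_graphMeasure {Ω : Set Plane} (hΩ : IsOpen Ω) (hfin : volume Ω ≠ ⊤)
    {u : Plane → ℝ} (hu : Measurable u) {φ : Plane × ℝ → ℝ}
    (hφ : φ =ᵐ[volume.restrict (Ω ×ˢ (univ : Set ℝ))] subgraphFn u) :
    IsNegDerivGamma Ω φ (graphMeasure Ω u) := by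
  have hmap : Measurable fun x : Plane => (x, u x) := measurable_id.prodMk hu
  have hUm : MeasurableSet (Ω ×ˢ (univ : Set ℝ)) := hΩ.measurableSet.prod MeasurableSet.univ
  refine ⟨?_, ?_, fun w hw => ?_⟩
  · rw [graphMeasure, Measure.map_apply hmap MeasurableSet.univ]
    simpa using lt_top_iff_ne_top.2 hfin
  · rw [graphMeasure, Measure.map_apply hmap hUm.compl, Measure.restrict_apply (hmap hUm.compl)]
    convert measure_empty (μ := (volume : Measure Plane))
    ext x
    simp
  · have hdiff : Differentiable ℝ w := hw.contDiff.differentiable one_ne_zero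
    have hInt := integrable_deriv_snd hw
    have h1 : ∫ p in Ω ×ˢ (univ : Set ℝ), φ p * deriv (fun t => w (p.1, t)) p.2
        = ∫ p in Ω ×ˢ (univ : Set ℝ), {q : Plane × ℝ | q.2 < u q.1}.indicator
            (fun p => deriv (fun t => w (p.1, t)) p.2) p := by
      refine integral_congr_ae ?_
      filter_upwards [hφ] with p hp
      rw [hp, subgraphFn]
      by_cases h : p ∈ {q : Plane × ℝ | q.2 < u q.1}
      · rw [indicator_of_mem h, indicator_of_mem h]; simp
      · rw [indicator_of_notMem h, indicator_of_notMem h]; simp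
    have hi2 := hInt.indicator (measurableSet_subgraph hu)
    rw [h1, Measure.volume_eq_prod, setIntegral_prod _ hi2.integrableOn, graphMeasure,
      integral_map hmap.aemeasurable hdiff.continuous.aestronglyMeasurable]
    refine integral_congr_ae (Eventually.of_forall fun x => ?_)
    have h3 : ∀ t : ℝ, {q : Plane × ℝ | q.2 < u q.1}.indicator
        (fun p => deriv (fun t => w (p.1, t)) p.2) (x, t)
        = (Iio (u x)).indicator (deriv fun t => w (x, t)) t := by
      intro t
      by_cases ht : t < u x <;> simp [indicator, ht]
    have hc1 : ContDiff ℝ 1 fun t : ℝ => w (x, t) := hw.contDiff.comp (by fun_prop)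
    simp only [h3, Measure.restrict_univ]
    rw [integral_indicator measurableSet_Iio, ← integral_Iic_eq_integral_Iio,
      HasCompactSupport.integral_Iic_deriv_eq hc1 (hasCompactSupport_snd hw.hasCompactSupport x)]

lemma negDerivGamma_eq {Ω : Set Plane} (hΩ : IsOpen Ω) (hfin : volume Ω ≠ ⊤)
    {u : Plane → ℝ} (hu : Measurable u) {φ : Plane × ℝ → ℝ}
    (hφ : φ =ᵐ[volume.restrict (Ω ×ˢ (univ : Set ℝ))] subgraphFn u) :
    negDerivGamma Ω φ = graphMeasure Ω u := by
  have h := isNegDerivGamma_graphMeasure hΩ hfin hu hφ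
  have hex : ∃ m, IsNegDerivGamma Ω φ m := ⟨_, h⟩
  rw [negDerivGamma, dif_pos hex]
  exact hex.choose_spec.unique hΩ h

/-! ### Divergences and the total variation of a subgraph -/

lemma continuous_div {ξ : Plane → Plane} (hξ : ContDiff ℝ 1 ξ) : Continuous (div ξ) := by
  have := hξ.continuous_fderiv one_ne_zero
  unfold div
  fun_prop

lemma hasCompactSupport_div {ξ : Plane → Plane} (hc : HasCompactSupport ξ) :
    HasCompactSupport (div ξ) :=
  (hc.fderiv ℝ).comp_left
    (g := fun L : Plane →L[ℝ] Plane => ∑ i : Fin 2, (L (EuclideanSpace.single i 1)) i) (by simp)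

lemma integrable_div {U : Set Plane} {ξ : Plane → Plane} (hξ : IsTest U ξ) :
    Integrable (div ξ) :=
  (continuous_div hξ.contDiff).integrable_of_hasCompactSupport
    (hasCompactSupport_div hξ.hasCompactSupport)

lemma div_eq_zero_of_notMem {U : Set Plane} {ξ : Plane → Plane} (hξ : IsTest U ξ) {x : Plane}
    (hx : x ∉ U) : div ξ x = 0 := by
  have : fderiv ℝ ξ x = 0 := by
    by_contra h
    exact hx (hξ.tsupport_subset (support_fderiv_subset ℝ h))
  simp [div, this]

lemma integral_div_eq_zero {U : Set Plane} {ξ : Plane → Plane} (hξ : IsTest U ξ) :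
    ∫ x, div ξ x = 0 := by
  have hd : Differentiable ℝ ξ := hξ.contDiff.differentiable one_ne_zero
  have hcont := hξ.contDiff.continuous_fderiv one_ne_zero
  have hcomp : ∀ (i : Fin 2) (x v : Plane),
      fderiv ℝ (fun y => ξ y i) x v = (fderiv ℝ ξ x v) i := by
    intro i x v
    have := ((EuclideanSpace.proj (𝕜 := ℝ) i).hasFDerivAt.comp x (hd x).hasFDerivAt).fderiv
    exact congrArg (fun L => L v) this
  have hInt : ∀ i : Fin 2, Integrable fun x => (fderiv ℝ ξ x (EuclideanSpace.single i 1)) i := by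
    intro i
    refine Continuous.integrable_of_hasCompactSupport (by fun_prop)
      ((hξ.hasCompactSupport.fderiv ℝ).comp_left
        (g := fun L : Plane →L[ℝ] Plane => (L (EuclideanSpace.single i 1)) i) (by simp))
  unfold div
  rw [integral_finsetSum _ fun i _ => hInt i]
  refine Finset.sum_eq_zero fun i _ => ?_
  have hc : HasCompactSupport fun x => ξ x i :=
    hξ.hasCompactSupport.comp_left (g := fun y : Plane => y i) rfl
  have hdi : Differentiable ℝ fun x => ξ x i := fun x =>
    ((EuclideanSpace.proj (𝕜 := ℝ) i).hasFDerivAt.comp x (hd x).hasFDerivAt).differentiableAt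
  have := integral_mul_fderiv_eq_neg_fderiv_mul_of_integrable (μ := (volume : Measure Plane))
    (f := fun _ => (1 : ℝ)) (g := fun x => ξ x i) (v := EuclideanSpace.single i 1) (by simp)
    (by simpa [hcomp] using hInt i)
    (by simpa using hdi.continuous.integrable_of_hasCompactSupport hc)
    (fun x _ => differentiableAt_const _) (fun x _ => hdi x)
  simpa [hcomp] using this

lemma IsTest.fst {Ω : Set Plane} {F : Type*} [NormedAddCommGroup F] [NormedSpace ℝ F]
    {ξ : Plane × ℝ → F} (hξ : IsTest (Ω ×ˢ (univ : Set ℝ)) ξ) (γ : ℝ) :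
    IsTest Ω fun y => ξ (y, γ) := by
  have hsub : tsupport (fun y => ξ (y, γ)) ⊆ (fun y => (y, γ)) ⁻¹' tsupport ξ :=
    closure_minimal (fun y hy => subset_tsupport ξ hy)
      ((isClosed_tsupport ξ).preimage (by fun_prop))
  refine ⟨hξ.contDiff.comp (by fun_prop), ?_, fun y hy => (hξ.tsupport_subset (hsub hy)).1⟩
  refine HasCompactSupport.intro (hξ.hasCompactSupport.isCompact.image continuous_fst)
    fun y hy => ?_
  by_contra h
  exact hy ⟨(y, γ), subset_tsupport _ h, rfl⟩

lemma div_fst_eq {ξ : Plane × ℝ → Plane} (hξ : Differentiable ℝ ξ) (p : Plane × ℝ) :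
    div (fun y => ξ (y, p.2)) p.1
      = ∑ i : Fin 2, (fderiv ℝ ξ p (EuclideanSpace.single i 1, 0)) i := by
  have h1 : HasFDerivAt ξ (fderiv ℝ ξ p) (p.1, p.2) := (hξ p).hasFDerivAt
  have h2 : HasFDerivAt (fun y : Plane => (y, p.2))
      ((ContinuousLinearMap.id ℝ Plane).prod 0) p.1 :=
    (hasFDerivAt_id p.1).prodMk (hasFDerivAt_const p.2 p.1)
  have h3 := (h1.comp p.1 h2).fderiv
  unfold div
  refine Finset.sum_congr rfl fun i _ => ?_
  change (fderiv ℝ (ξ ∘ fun y : Plane => (y, p.2)) p.1 _) i = _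
  rw [h3]
  simp

lemma integrable_div_fst {U : Set (Plane × ℝ)} {ξ : Plane × ℝ → Plane} (hξ : IsTest U ξ) :
    Integrable fun p : Plane × ℝ => div (fun y => ξ (y, p.2)) p.1 := by
  have hcont := hξ.contDiff.continuous_fderiv one_ne_zero
  simp_rw [div_fst_eq (hξ.contDiff.differentiable one_ne_zero)]
  refine Continuous.integrable_of_hasCompactSupport (by fun_prop)
    ((hξ.hasCompactSupport.fderiv ℝ).comp_left
      (g := fun L : Plane × ℝ →L[ℝ] Plane =>
        ∑ i : Fin 2, (L (EuclideanSpace.single i 1, 0)) i) (by simp))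

lemma measurable_subgraphFn {u : Plane → ℝ} (hu : Measurable u) : Measurable (subgraphFn u) :=
  measurable_one.indicator (measurableSet_subgraph hu)

lemma subgraphFn_nonneg (u : Plane → ℝ) (p : Plane × ℝ) : 0 ≤ subgraphFn u p :=
  indicator_nonneg (fun _ _ => zero_le_one) p

lemma subgraphFn_le_one (u : Plane → ℝ) (p : Plane × ℝ) : subgraphFn u p ≤ 1 :=
  indicator_le_self' (fun _ _ => zero_le_one) p

lemma norm_subgraphFn_le (u : Plane → ℝ) (p : Plane × ℝ) : ‖subgraphFn u p‖ ≤ 1 := by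
  rw [Real.norm_of_nonneg (subgraphFn_nonneg u p)]
  exact subgraphFn_le_one u p

lemma subgraphFn_of_lt {u : Plane → ℝ} {x : Plane} {t : ℝ} (h : t < u x) :
    subgraphFn u (x, t) = 1 :=
  indicator_of_mem (by exact h) _

lemma subgraphFn_of_le {u : Plane → ℝ} {x : Plane} {t : ℝ} (h : u x ≤ t) :
    subgraphFn u (x, t) = 0 :=
  indicator_of_notMem (by exact not_lt.2 h) _

lemma ofReal_integral_le_lintegral {α : Type*} [MeasurableSpace α] {μ : Measure α} {k : α → ℝ}
    (hk : Integrable k μ) : ENNReal.ofReal (∫ x, k x ∂μ) ≤ ∫⁻ x, ENNReal.ofReal (k x) ∂μ := by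
  rw [integral_eq_lintegral_pos_part_sub_lintegral_neg_part hk]
  exact (ENNReal.ofReal_le_ofReal (sub_le_self _ ENNReal.toReal_nonneg)).trans
    ENNReal.ofReal_toReal_le

/-- The two parts of the divergence are estimated separately. The horizontal part is integrated
slice by slice; slices outside `[0,1]` are constant in `x` and contribute nothing, by
`integral_div_eq_zero`. The vertical part is an integral of `η` over the graph, at most the area of
`Ω`. This is what makes the limit function a competitor. -/
lemma liftedTV_subgraphFn_le {Ω : Set Plane} (hΩ : IsOpen Ω) (hfin : volume Ω ≠ ⊤)
    {u : Plane → ℝ} (hu : Measurable u) (hu01 : ∀ x, u x ∈ Icc (0 : ℝ) 1) :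
    liftedTV Ω (subgraphFn u) ≤
      (∫⁻ γ in Icc (0 : ℝ) 1, TV Ω (fun x => subgraphFn u (x, γ))) + volume Ω := by
  have hm := measurable_subgraphFn hu
  refine iSup_le fun ξ => iSup_le fun η => iSup_le fun hξ => iSup_le fun hη => iSup_le fun hb => ?_
  have hφ1 : ∀ {k : Plane × ℝ → ℝ}, Integrable k → Integrable fun p => subgraphFn u p * k p :=
    fun hk => hk.bdd_mul hm.aestronglyMeasurable (Eventually.of_forall (norm_subgraphFn_le u))
  have hi1 := hφ1 (integrable_div_fst hξ)
  have hi2 := hφ1 (integrable_deriv_snd hη)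
  have hsplit : ∫ p in Ω ×ˢ (univ : Set ℝ), subgraphFn u p * liftedDiv ξ η p
      = (∫ p in Ω ×ˢ (univ : Set ℝ), subgraphFn u p * div (fun y => ξ (y, p.2)) p.1)
        + ∫ p in Ω ×ˢ (univ : Set ℝ), subgraphFn u p * deriv (fun t => η (p.1, t)) p.2 := by
    rw [← integral_add hi1.integrableOn hi2.integrableOn]
    simp only [liftedDiv, mul_add]
  rw [hsplit]
  refine ENNReal.ofReal_add_le.trans (add_le_add ?_ ?_)
  · rw [Measure.volume_eq_prod, ← Measure.prod_restrict, Measure.restrict_univ]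
    have hi1' : Integrable (fun p : Plane × ℝ => subgraphFn u p * div (fun y => ξ (y, p.2)) p.1)
        ((volume.restrict Ω).prod volume) := by
      have := hi1.integrableOn (s := Ω ×ˢ univ)
      rwa [IntegrableOn, Measure.volume_eq_prod, ← Measure.prod_restrict,
        Measure.restrict_univ] at this
    rw [integral_prod_symm _ hi1']
    refine (ofReal_integral_le_lintegral hi1'.integral_prod_right).trans ?_
    rw [← lintegral_indicator measurableSet_Icc]
    refine lintegral_mono fun γ => ?_
    by_cases hγ : γ ∈ Icc (0 : ℝ) 1
    · rw [indicator_of_mem hγ]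
      refine le_iSup_of_le (fun y => ξ (y, γ)) (le_iSup_of_le (hξ.fst γ)
        (le_iSup_of_le (fun x => ?_) le_rfl))
      have := hb (x, γ)
      have h0 := sq_nonneg (η (x, γ))
      exact (sq_le_one_iff₀ (norm_nonneg _)).1 (by linarith)
    · rw [indicator_of_notMem hγ]
      rcases lt_or_ge γ 0 with h | h
      · have : ∀ x, subgraphFn u (x, γ) = 1 := fun x => subgraphFn_of_lt (h.trans_le (hu01 x).1)
        simp only [this, one_mul]
        rw [setIntegral_eq_integral_of_forall_compl_eq_zero
          fun x hx => div_eq_zero_of_notMem (hξ.fst γ) hx, integral_div_eq_zero (hξ.fst γ)]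
        simp
      · have h1 : 1 < γ := by
          by_contra hc
          exact hγ ⟨h, not_lt.1 hc⟩
        have : ∀ x, subgraphFn u (x, γ) = 0 := fun x =>
          subgraphFn_of_le ((hu01 x).2.trans h1.le)
        simp [this]
  · rw [(isNegDerivGamma_graphMeasure hΩ hfin hu (ae_eq_refl _)).integral_eq η hη, graphMeasure,
      integral_map (measurable_id'.prodMk hu).aemeasurable
        hη.contDiff.continuous.aestronglyMeasurable]
    refine ENNReal.ofReal_le_of_le_toReal ?_
    have := norm_setIntegral_le_of_norm_le_const (μ := (volume : Measure Plane)) (s := Ω) (C := 1)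
      (f := fun x => η (x, u x)) (lt_top_iff_ne_top.2 hfin) (fun x _ => ?_)
    · rw [one_mul] at this
      exact (Real.le_norm_self _).trans this
    · have h1 := hb (x, u x)
      have h0 := sq_nonneg ‖ξ (x, u x)‖
      rw [Real.norm_eq_abs]
      exact (sq_le_one_iff_abs_le_one _).1 (by linarith)

lemma isLifted_subgraphFn {Ω : Set Plane} (hΩ : IsOpen Ω) (hfin : volume Ω ≠ ⊤)
    {u : Plane → ℝ} (hu : Measurable u) (hu01 : ∀ x, u x ∈ Icc (0 : ℝ) 1)
    (hT : ∫⁻ γ in Icc (0 : ℝ) 1, TV Ω (fun x => subgraphFn u (x, γ)) ≠ ⊤) :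
    IsLifted Ω (subgraphFn u) := by
  refine ⟨(measurable_subgraphFn hu).aestronglyMeasurable, Eventually.of_forall fun p => ?_, ?_,
    ?_, ?_, fun w hw hw0 => ?_⟩
  · rcases lt_or_ge p.2 (u p.1) with h | h
    · exact Or.inr (subgraphFn_of_lt h)
    · exact Or.inl (subgraphFn_of_le h)
  · exact (liftedTV_subgraphFn_le hΩ hfin hu hu01).trans_lt
      (ENNReal.add_lt_top.2 ⟨lt_top_iff_ne_top.2 hT, lt_top_iff_ne_top.2 hfin⟩)
  · have h0 : ∀ᵐ p : Plane × ℝ, p.2 ≠ 0 := by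
      refine (Measure.ae_prod_iff_ae_ae (μ := (volume : Measure Plane))
        (ν := (volume : Measure ℝ)) (measurable_snd (measurableSet_singleton 0)).compl).2
        (Eventually.of_forall fun x => ?_)
      exact compl_mem_ae_iff.2 (measure_singleton (μ := (volume : Measure ℝ)) 0)
    rw [ae_restrict_iff' (hΩ.measurableSet.prod measurableSet_Iic)]
    filter_upwards [h0] with p hp hpm
    exact subgraphFn_of_lt ((lt_of_le_of_ne hpm.2 hp).trans_le (hu01 p.1).1)
  · rw [ae_restrict_iff' (hΩ.measurableSet.prod measurableSet_Ici)]
    exact Eventually.of_forall fun p hpm => subgraphFn_of_le ((hu01 p.1).2.trans hpm.2)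
  · rw [(isNegDerivGamma_graphMeasure hΩ hfin hu (ae_eq_refl _)).integral_eq w hw]
    exact integral_nonneg hw0

/-! ### Compactness under a variation bound -/

lemma div_smul_const {a : Plane → ℝ} (ha : Differentiable ℝ a) (h x : Plane) :
    div (fun y => a y • h) x = fderiv ℝ a x h := by
  have h1 : fderiv ℝ (fun y => a y • h) x = (fderiv ℝ a x).smulRight h :=
    ((ha x).hasFDerivAt.smul_const h).fderiv
  have h2 : h = ∑ i : Fin 2, h i • (EuclideanSpace.single i 1 : Plane) := by
    ext j
    fin_cases j <;> simp
  unfold div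
  rw [h1]
  conv_rhs => rw [h2, map_sum]
  refine Finset.sum_congr rfl fun i _ => ?_
  simp [mul_comm]

/-- The left side is a limit of integrals of `v(x + h) - v(x)` against mollified signs `w n`. Moving
the translation onto `w n` produces the divergence of a field parallel to `h`. The margin `2 * δ`
pays once for the mollification and once for the segment of length at most `δ`. -/
lemma setIntegral_abs_translate_le {Ω : Set Plane} {v : Plane → ℝ} (hvm : Measurable v)
    (hv : Integrable v) {M : ℝ}
    (hM : ∀ ξ, IsTest Ω ξ → (∀ x, ‖ξ x‖ ≤ 1) → ∫ x in Ω, v x * div ξ x ≤ M)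
    {K : Set Plane} (hK : IsCompact K) {δ : ℝ} (hδ : 0 < δ)
    (hKΩ : Metric.cthickening (2 * δ) K ⊆ Ω) {h : Plane} (hh : ‖h‖ ≤ δ) :
    ∫ x in K, |v (x + h) - v x| ≤ ‖h‖ * M := by
  rcases eq_or_ne h 0 with rfl | hne
  · simp
  have hpos : 0 < ‖h‖ := norm_pos_iff.2 hne
  let d : Plane → ℝ := fun x => v (x + h) - v x
  have hdm : Measurable d := (hvm.comp (measurable_add_const h)).sub hvm
  have hdi : Integrable d := (hv.comp_add_right h).sub hv
  let s : Plane → ℝ := K.indicator fun x => if 0 ≤ d x then 1 else -1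
  have hs : Measurable s := Measurable.indicator
    (Measurable.ite (measurableSet_le measurable_const hdm) measurable_const measurable_const)
    hK.measurableSet
  have hs1 : ∀ x, |s x| ≤ 1 := by
    intro x
    by_cases hx : x ∈ K
    · by_cases h0 : 0 ≤ d x <;> simp [s, hx, h0]
    · simp [s, hx]
  obtain ⟨w, hwC, hws, hw1, -, hwlim⟩ := exists_smooth_approx (volume : Measure Plane) hδ hs hs1
    (K := K) (fun x hx => indicator_of_notMem hx _)
  have hC : IsCompact (Metric.cthickening δ K) := hK.cthickening
  have hwc : ∀ n, HasCompactSupport (w n) := fun n =>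
    hC.of_isClosed_subset (isClosed_tsupport _) (hws n)
  have hkey : ∀ n, ∫ x, d x * w n x ≤ ‖h‖ * M := by
    intro n
    have hCD := contDiff_segAvg (hwC n) (hwc n) h
    -- The factor makes `a • h` have norm at most `1`; the sign is chosen so that its divergence is
    -- `‖h‖⁻¹ (w(x - h) - w(x))`.
    let a : Plane → ℝ := fun y => (-‖h‖⁻¹) * segAvg h (w n) y
    have hts : tsupport (fun y => a y • h) ⊆ tsupport (segAvg h (w n)) := by
      refine closure_mono fun y hy => ?_
      rw [Function.mem_support] at hy ⊢
      contrapose! hy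
      simp [a, hy]
    have htest : IsTest Ω fun y => a y • h := by
      refine ⟨(contDiff_const.mul hCD).smul contDiff_const,
        (hasCompactSupport_segAvg (hwc n) h).of_isClosed_subset (isClosed_tsupport _) hts, ?_⟩
      refine hts.trans ((tsupport_segAvg_subset (hwc n) h).trans ?_)
      rintro _ ⟨⟨t, q⟩, ⟨ht, hq⟩, rfl⟩
      refine hKΩ ?_
      have hq' : q + t • h ∈ Metric.cthickening δ (Metric.cthickening δ K) := by
        refine Metric.mem_cthickening_of_dist_le _ q δ _ (hws n hq) ?_
        have ht' : t ∈ Icc (0 : ℝ) 1 := ht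
        rw [dist_eq_norm, add_sub_cancel_left, norm_smul, Real.norm_of_nonneg ht'.1]
        exact (mul_le_of_le_one_left (norm_nonneg _) ht'.2).trans hh
      have := Metric.cthickening_cthickening_subset hδ.le hδ.le K hq'
      rwa [← two_mul] at this
    have hnorm : ∀ x, ‖a x • h‖ ≤ 1 := by
      intro x
      rw [norm_smul, norm_mul, norm_neg, norm_inv, norm_norm, mul_right_comm,
        inv_mul_cancel₀ hpos.ne', one_mul]
      exact abs_segAvg_le (hw1 n) h x
    have hdiv : ∀ x, div (fun y => a y • h) x = ‖h‖⁻¹ * (w n (x - h) - w n x) := by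
      intro x
      have hD := hCD.differentiable one_ne_zero
      rw [div_smul_const (hD.const_mul _), fderiv_const_mul (hD x)]
      simp only [smul_apply, smul_eq_mul, fderiv_segAvg (hwC n) (hwc n)]
      ring
    have h1 := hM _ htest hnorm
    rw [setIntegral_eq_integral_of_forall_compl_eq_zero
      (fun x hx => by rw [div_eq_zero_of_notMem htest hx, mul_zero])] at h1
    have hi0 : ∀ {k : Plane → ℝ}, Integrable k → Integrable fun x => k x * w n x := fun hk =>
      hk.mul_bdd (hwC n).continuous.aestronglyMeasurable (Eventually.of_forall (hw1 n))
    have hi1 : Integrable fun x => v x * w n (x - h) :=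
      hv.mul_bdd ((hwC n).continuous.comp (by fun_prop)).aestronglyMeasurable
        (Eventually.of_forall fun x => hw1 n _)
    have h2 : ∫ x, v x * w n (x - h) = ∫ x, v (x + h) * w n x := by
      rw [← integral_add_right_eq_self _ h]
      simp
    have h3 : ∫ x, v x * div (fun y => a y • h) x = ‖h‖⁻¹ * ∫ x, d x * w n x := by
      calc _ = ∫ x, ‖h‖⁻¹ * (v x * w n (x - h) - v x * w n x) := by
            refine integral_congr_ae (Eventually.of_forall fun x => ?_)
            simp only [hdiv]
            ring
        _ = ‖h‖⁻¹ * ((∫ x, v (x + h) * w n x) - ∫ x, v x * w n x) := by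
            rw [integral_const_mul, integral_sub hi1 (hi0 hv), h2]
        _ = _ := by
            rw [← integral_sub (hi0 (hv.comp_add_right h)) (hi0 hv)]
            simp only [d, sub_mul]
    rw [h3] at h1
    calc ∫ x, d x * w n x = ‖h‖ * (‖h‖⁻¹ * ∫ x, d x * w n x) := by
          rw [mul_inv_cancel_left₀ hpos.ne']
      _ ≤ ‖h‖ * M := mul_le_mul_of_nonneg_left h1 hpos.le
  have hlim : Tendsto (fun n => ∫ x, d x * w n x) atTop (𝓝 (∫ x, d x * s x)) := by
    refine tendsto_integral_of_dominated_convergence (fun x => |d x|) (fun n => ?_) hdi.abs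
      (fun n => Eventually.of_forall fun x => ?_) ?_
    · exact (hdm.mul (hwC n).continuous.measurable).aestronglyMeasurable
    · rw [norm_mul]
      exact mul_le_of_le_one_right (norm_nonneg _) (hw1 n x)
    · filter_upwards [hwlim] with x hx
      exact hx.const_mul _
  have hval : ∫ x, d x * s x = ∫ x in K, |v (x + h) - v x| := by
    rw [← integral_indicator hK.measurableSet]
    refine integral_congr_ae (Eventually.of_forall fun x => ?_)
    by_cases hx : x ∈ K
    · by_cases h0 : 0 ≤ d x
      · simp only [s, indicator_of_mem hx, if_pos h0, mul_one]
        exact (abs_of_nonneg h0).symm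
      · simp only [s, indicator_of_mem hx, if_neg h0, mul_neg, mul_one]
        exact (abs_of_neg (not_le.1 h0)).symm
    · simp [s, hx]
  rw [← hval]
  exact le_of_tendsto' hlim hkey

/-- Compare `v x` with its values over the ball of radius `δ`: the oscillation is controlled by the
translation estimate, averaged over `h`, and what remains is a ball integral, a quantity that weak
convergence sees. -/
lemma setIntegral_abs_le_add_ballIntegral {Ω : Set Plane} {v : Plane → ℝ} (hvm : Measurable v)
    (hv : Integrable v) {M : ℝ}
    (hM : ∀ ξ, IsTest Ω ξ → (∀ x, ‖ξ x‖ ≤ 1) → ∫ x in Ω, v x * div ξ x ≤ M) (hM0 : 0 ≤ M)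
    {K : Set Plane} (hK : IsCompact K) {δ : ℝ} (hδ : 0 < δ)
    (hKΩ : Metric.cthickening (2 * δ) K ⊆ Ω) :
    volume.real (Metric.ball (0 : Plane) δ) * ∫ x in K, |v x| ≤
      volume.real (Metric.ball (0 : Plane) δ) * (δ * M) +
        ∫ x in K, |∫ h in Metric.ball (0 : Plane) δ, v (x + h)| := by
  set B := Metric.ball (0 : Plane) δ with hB
  have hKtop : volume K ≠ ⊤ := hK.measure_lt_top.ne
  have hBtop : volume B ≠ ⊤ := measure_ball_lt_top.ne
  have : IsFiniteMeasure (volume.restrict B) := isFiniteMeasure_restrict.2 hBtop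
  have : IsFiniteMeasure (volume.restrict K) := isFiniteMeasure_restrict.2 hKtop
  have hadd : Integrable (fun q : Plane × Plane => v (q.1 + q.2))
      ((volume.restrict K).prod (volume.restrict B)) := by
    refine (integrable_prod_iff (hvm.comp (by fun_prop)).aestronglyMeasurable).2 ⟨?_, ?_⟩
    · exact Eventually.of_forall fun x => (hv.comp_add_left x).integrableOn
    · refine Integrable.of_bound (C := ∫ y, ‖v y‖) ?_ (Eventually.of_forall fun x => ?_)
      · exact ((hvm.comp (g := v) (f := fun q : Plane × Plane => q.1 + q.2)
          (by fun_prop)).norm.stronglyMeasurable.integral_prod_right).aestronglyMeasurable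
      · rw [Real.norm_of_nonneg (integral_nonneg fun _ => norm_nonneg _)]
        calc ∫ y in B, ‖v (x + y)‖ ≤ ∫ y, ‖v (x + y)‖ :=
              setIntegral_le_integral (hv.comp_add_left x).norm
                (Eventually.of_forall fun _ => norm_nonneg _)
          _ = ∫ y, ‖v y‖ := integral_add_left_eq_self (fun y => ‖v y‖) x
  have hfst : Integrable (fun q : Plane × Plane => v q.1)
      ((volume.restrict K).prod (volume.restrict B)) := hv.integrableOn.comp_fst _
  have hdiff := (hadd.sub hfst).abs
  have hA : Integrable (fun x => ∫ h in B, v (x + h)) (volume.restrict K) :=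
    hadd.integral_prod_left
  have hptw : ∀ x, volume.real B * |v x| ≤
      (∫ h in B, |v (x + h) - v x|) + |∫ h in B, v (x + h)| := by
    intro x
    have hi := (hv.comp_add_left x).integrableOn (s := B)
    have e : volume.real B * v x = (∫ h in B, v (x + h)) - ∫ h in B, (v (x + h) - v x) := by
      rw [integral_sub hi (integrable_const _)]
      simp
    calc volume.real B * |v x| = |volume.real B * v x| := by
          rw [abs_mul, abs_of_nonneg measureReal_nonneg]
      _ ≤ |∫ h in B, v (x + h)| + |∫ h in B, (v (x + h) - v x)| := by
          rw [e]; exact abs_sub _ _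
      _ ≤ _ := by
          rw [add_comm]
          exact add_le_add_left (abs_integral_le_integral_abs) _
  calc volume.real B * ∫ x in K, |v x| = ∫ x in K, volume.real B * |v x| :=
        (integral_const_mul _ _).symm
    _ ≤ ∫ x in K, ((∫ h in B, |v (x + h) - v x|) + |∫ h in B, v (x + h)|) := by
        refine integral_mono (hv.integrableOn.abs.const_mul _)
          (hdiff.integral_prod_left.add hA.abs) hptw
    _ = (∫ x in K, ∫ h in B, |v (x + h) - v x|) + ∫ x in K, |∫ h in B, v (x + h)| :=
        integral_add hdiff.integral_prod_left hA.abs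
    _ = (∫ h in B, ∫ x in K, |v (x + h) - v x|) + ∫ x in K, |∫ h in B, v (x + h)| := by
        rw [integral_integral_swap hdiff]
    _ ≤ _ := by
        refine add_le_add_left ?_ _
        calc ∫ h in B, ∫ x in K, |v (x + h) - v x| ≤ ∫ h in B, δ * M := by
              refine setIntegral_mono_on hdiff.integral_prod_right (integrable_const _)
                measurableSet_ball fun h hh => ?_
              have hh' : ‖h‖ ≤ δ := by simpa [hB] using (mem_ball_zero_iff.1 hh).le
              exact (setIntegral_abs_translate_le hvm hv hM hK hδ hKΩ hh').trans
                (mul_le_mul_of_nonneg_right hh' hM0)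
          _ = volume.real B * (δ * M) := by simp

/-- For a finite measure on a countably generated σ-algebra, `L²` is separable, so balls of its dual
are weak-* sequentially compact; the Riesz isomorphism returns the limit functional to `L²`. -/
lemma exists_weak_limit {α : Type*} [MeasurableSpace α] [MeasurableSpace.CountablyGenerated α]
    (μ : Measure α) [IsFiniteMeasure μ] {u : ℕ → α → ℝ} (hu : ∀ n, Measurable (u n))
    (hu1 : ∀ n x, |u n x| ≤ 1) :
    ∃ (w : α → ℝ) (k : ℕ → ℕ), StrictMono k ∧ Measurable w ∧ MemLp w 2 μ ∧
      ∀ g : α → ℝ, MemLp g 2 μ →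
        Tendsto (fun n => ∫ x, u (k n) x * g x ∂μ) atTop (𝓝 (∫ x, w x * g x ∂μ)) := by
  have hmem : ∀ n, MemLp (u n) 2 μ := fun n =>
    MemLp.of_bound (hu n).aestronglyMeasurable 1 (Eventually.of_forall (hu1 n))
  let H := Lp ℝ 2 μ
  let U : ℕ → H := fun n => (hmem n).toLp (u n)
  obtain ⟨R, hR⟩ : ∃ R : ℝ, ∀ n, ‖U n‖ ≤ R := by
    refine ⟨μ.real univ ^ ((2 : ENNReal).toReal)⁻¹ * 1, fun n => ?_⟩
    refine Lp.norm_le_of_ae_bound zero_le_one ?_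
    filter_upwards [(hmem n).coeFn_toLp] with x hx
    rw [hx]; exact hu1 n x
  let T : ℕ → WeakDual ℝ H := fun n =>
    StrongDual.toWeakDual (InnerProductSpace.toDual ℝ H (U n))
  have hT : ∀ n, T n ∈ WeakDual.toStrongDual ⁻¹' Metric.closedBall (0 : StrongDual ℝ H) R := by
    intro n
    simp only [mem_preimage, mem_closedBall_zero_iff]
    change ‖InnerProductSpace.toDual ℝ H (U n)‖ ≤ R
    rw [LinearIsometryEquiv.norm_map]
    exact hR n
  have : Fact ((2 : ENNReal) ≠ ⊤) := ⟨by simp⟩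
  obtain ⟨S, -, k, hk, hlim⟩ := WeakDual.isSeqCompact_closedBall ℝ H (0 : StrongDual ℝ H) R hT
  let W : H := (InnerProductSpace.toDual ℝ H).symm (WeakDual.toStrongDual S)
  have hWm := (Lp.aestronglyMeasurable W)
  refine ⟨hWm.mk W, k, hk, hWm.stronglyMeasurable_mk.measurable,
    (memLp_congr_ae hWm.ae_eq_mk).1 (Lp.memLp W), fun g hg => ?_⟩
  have h1 : Tendsto (fun n => T (k n) (hg.toLp g)) atTop (𝓝 (S (hg.toLp g))) :=
    ((WeakDual.eval_continuous (hg.toLp g)).tendsto S).comp hlim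
  have e1 : ∀ n, T (k n) (hg.toLp g) = ∫ x, u (k n) x * g x ∂μ := by
    intro n
    change inner ℝ (U (k n)) (hg.toLp g) = _
    rw [L2.inner_def]
    refine integral_congr_ae ?_
    filter_upwards [(hmem (k n)).coeFn_toLp, hg.coeFn_toLp] with x h1 h2
    simp only [U]
    rw [h1, h2]
    simp [mul_comm]
  have e2 : S (hg.toLp g) = ∫ x, hWm.mk W x * g x ∂μ := by
    have : S (hg.toLp g) = inner ℝ W (hg.toLp g) :=
      (InnerProductSpace.toDual_symm_apply (x := hg.toLp g) (y := WeakDual.toStrongDual S)).symm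
    rw [this, L2.inner_def]
    refine integral_congr_ae ?_
    filter_upwards [hWm.ae_eq_mk, hg.coeFn_toLp] with x h1 h2
    rw [h1, h2]
    simp [mul_comm]
  simpa only [e1, e2] using h1

lemma IsTest.neg {U : Set Plane} {ξ : Plane → Plane} (hξ : IsTest U ξ) : IsTest U fun x => -ξ x := by
  have hs : tsupport (fun x => -ξ x) = tsupport ξ := by
    simp only [tsupport]
    congr 1
    ext x
    simp
  refine ⟨hξ.contDiff.neg, ?_, by rw [hs]; exact hξ.tsupport_subset⟩
  rw [HasCompactSupport, hs]
  exact hξ.hasCompactSupport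

lemma div_neg (ξ : Plane → Plane) (x : Plane) : div (fun y => -ξ y) x = -div ξ x := by
  simp [div, fderiv_fun_neg]

/-- A variation bound upgrades weak convergence to strong convergence on compact sets: the
oscillation is uniformly small for small `δ`, and for that fixed `δ` the ball integrals tend to zero
pointwise, dominated by the integral of `G`. -/
lemma tendsto_setIntegral_abs_of_weak {Ω : Set Plane} (hΩ : IsOpen Ω) {v : ℕ → Plane → ℝ}
    (hvm : ∀ n, Measurable (v n)) {G : Plane → ℝ} (hG : Integrable G)
    (hvG : ∀ n x, |v n x| ≤ G x) {M : ℝ} (hM0 : 0 ≤ M)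
    (hM : ∀ n ξ, IsTest Ω ξ → (∀ x, ‖ξ x‖ ≤ 1) → ∫ x in Ω, v n x * div ξ x ≤ M)
    (hweak : ∀ (x : Plane) (r : ℝ),
      Tendsto (fun n => ∫ y in Metric.ball x r, v n y) atTop (𝓝 0))
    {K : Set Plane} (hK : IsCompact K) (hKΩ : K ⊆ Ω) :
    Tendsto (fun n => ∫ x in K, |v n x|) atTop (𝓝 0) := by
  have hv : ∀ n, Integrable (v n) := fun n =>
    hG.mono' (hvm n).aestronglyMeasurable (Eventually.of_forall (hvG n))
  obtain ⟨δ₀, hδ₀, hδ₀Ω⟩ := hK.exists_cthickening_subset_open hΩ hKΩ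
  have hKtop : volume K ≠ ⊤ := hK.measure_lt_top.ne
  have : IsFiniteMeasure (volume.restrict K) := isFiniteMeasure_restrict.2 hKtop
  refine Metric.tendsto_atTop.2 fun η hη => ?_
  -- The first bound keeps the `2 * δ`-thickening of `K` in `Ω`; the second gives `δ * M < η / 2`,
  -- with `M + 1` guarding against `M = 0`.
  let δ := min (δ₀ / 2) (η / (2 * (M + 1)))
  have hδ : 0 < δ := lt_min (by positivity) (by positivity)
  have hδΩ : Metric.cthickening (2 * δ) K ⊆ Ω := by
    refine (Metric.cthickening_mono ?_ K).trans hδ₀Ω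
    have : δ ≤ δ₀ / 2 := min_le_left _ _
    linarith
  have hδM : δ * M < η / 2 := by
    have h1 : δ ≤ η / (2 * (M + 1)) := min_le_right _ _
    calc δ * M < δ * (M + 1) := by nlinarith
      _ ≤ η / (2 * (M + 1)) * (M + 1) := mul_le_mul_of_nonneg_right h1 (by linarith)
      _ = η / 2 := by field_simp
  let V := volume.real (Metric.ball (0 : Plane) δ)
  have hV : 0 < V :=
    ENNReal.toReal_pos (Metric.measure_ball_pos volume _ hδ).ne' measure_ball_lt_top.ne
  have hshift : ∀ n x, ∫ h in Metric.ball (0 : Plane) δ, v n (x + h)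
      = ∫ y in Metric.ball x δ, v n y := by
    intro n x
    rw [← integral_indicator measurableSet_ball, ← integral_indicator measurableSet_ball,
      ← integral_add_left_eq_self ((Metric.ball x δ).indicator (v n)) x]
    refine integral_congr_ae (Eventually.of_forall fun h => ?_)
    by_cases hh : ‖h‖ < δ <;> simp [indicator, hh]
  have hA : Tendsto (fun n => ∫ x in K, |∫ h in Metric.ball (0 : Plane) δ, v n (x + h)|) atTop
      (𝓝 0) := by
    have h0 : (0 : ℝ) = ∫ x in K, (0 : ℝ) := by simp
    rw [h0]
    refine tendsto_integral_of_dominated_convergence (fun _ => ∫ y, G y) (fun n => ?_)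
      (integrable_const _) (fun n => Eventually.of_forall fun x => ?_)
      (Eventually.of_forall fun x => ?_)
    · have hm : Measurable (Function.uncurry fun x h : Plane => v n (x + h)) :=
        (hvm n).comp (by fun_prop)
      exact hm.stronglyMeasurable.integral_prod_right.aestronglyMeasurable.norm
    · rw [hshift, Real.norm_eq_abs, abs_abs, ← Real.norm_eq_abs]
      calc ‖∫ y in Metric.ball x δ, v n y‖ ≤ ∫ y in Metric.ball x δ, G y :=
            norm_integral_le_of_norm_le hG.integrableOn (Eventually.of_forall (hvG n))
        _ ≤ ∫ y, G y := setIntegral_le_integral hG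
            (Eventually.of_forall fun y => (abs_nonneg _).trans (hvG n y))
    · simp only [hshift]
      simpa using (hweak x δ).abs
  obtain ⟨N, hN⟩ := Metric.tendsto_atTop.1 hA (V * (η / 2)) (by positivity)
  refine ⟨N, fun n hn => ?_⟩
  have h1 := setIntegral_abs_le_add_ballIntegral (hvm n) (hv n) (hM n) hM0 hK hδ hδΩ
  have h2 := hN n hn
  rw [Real.dist_0_eq_abs] at h2 ⊢
  have h2' := (le_abs_self _).trans_lt h2
  rw [abs_of_nonneg (integral_nonneg fun _ => abs_nonneg _)]
  have h3 : V * ∫ x in K, |v n x| < V * η := by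
    calc V * ∫ x in K, |v n x| ≤ _ := h1
      _ < V * (δ * M) + V * (η / 2) := by
        have := h2'
        exact add_lt_add_right this _
      _ ≤ V * η := by nlinarith
  exact lt_of_mul_lt_mul_left h3 hV.le

/-- The weak limit inherits the variation bound, so the differences converge strongly on compact
subsets. The common integrable majorant makes the mass near the boundary uniformly small, giving
`L¹` convergence in `Ω` and then a.e. convergence of a further subsequence. -/
lemma exists_subseq_tendsto_ae {Ω : Set Plane} (hΩ : IsOpen Ω) (hfin : volume Ω ≠ ⊤)
    {u : ℕ → Plane → ℝ} (hu : ∀ n, Measurable (u n)) (hu01 : ∀ n x, u n x ∈ Icc (0 : ℝ) 1)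
    {M : ℝ}
    (hM : ∀ n ξ, IsTest Ω ξ → (∀ x, ‖ξ x‖ ≤ 1) → ∫ x in Ω, u n x * div ξ x ≤ M) :
    ∃ (w : Plane → ℝ) (k : ℕ → ℕ), StrictMono k ∧ Measurable w ∧ (∀ x, w x ∈ Icc (0 : ℝ) 1) ∧
      ∀ᵐ x ∂(volume.restrict Ω), Tendsto (fun n => u (k n) x) atTop (𝓝 (w x)) := by
  have : IsFiniteMeasure (volume.restrict Ω) := isFiniteMeasure_restrict.2 hfin
  have hu1 : ∀ n x, |u n x| ≤ 1 := fun n x => by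
    rw [abs_of_nonneg (hu01 n x).1]; exact (hu01 n x).2
  have hM0 : 0 ≤ M := by
    have h0 : IsTest Ω (fun _ : Plane => (0 : Plane)) :=
      ⟨contDiff_const, HasCompactSupport.zero, by simp [tsupport]⟩
    simpa [div] using hM 0 _ h0 (by simp)
  obtain ⟨w, k, hk, hwm, hw2, hweak⟩ := exists_weak_limit (volume.restrict Ω) hu hu1
  have hw1 : IntegrableOn w Ω := hw2.integrable one_le_two
  have hui : ∀ n, IntegrableOn (u n) Ω := fun n =>
    Integrable.of_bound (hu n).aestronglyMeasurable 1 (Eventually.of_forall (hu1 n))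
  have hwM : ∀ ξ, IsTest Ω ξ → (∀ x, ‖ξ x‖ ≤ 1) → ∫ x in Ω, w x * div ξ x ≤ M := by
    intro ξ hξ hξ1
    refine le_of_tendsto' (hweak (div ξ) ?_) fun n => hM _ ξ hξ hξ1
    exact ((continuous_div hξ.contDiff).memLp_of_hasCompactSupport
      (hasCompactSupport_div hξ.hasCompactSupport)).restrict Ω
  have hdivb : ∀ ξ, IsTest Ω ξ → ∃ C, ∀ x, ‖div ξ x‖ ≤ C := fun ξ hξ =>
    (continuous_div hξ.contDiff).bounded_above_of_compact_support
      (hasCompactSupport_div hξ.hasCompactSupport)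
  let v : ℕ → Plane → ℝ := fun n => Ω.indicator fun x => u (k n) x - w x
  have hvm : ∀ n, Measurable (v n) := fun n =>
    ((hu _).sub hwm).indicator hΩ.measurableSet
  let G : Plane → ℝ := Ω.indicator fun x => 1 + |w x|
  have hG : Integrable G := by
    refine (integrable_indicator_iff hΩ.measurableSet).2 ?_
    exact (integrable_const (1 : ℝ)).add hw1.abs
  have hvG : ∀ n x, |v n x| ≤ G x := by
    intro n x
    by_cases hx : x ∈ Ω
    · simp only [v, G, indicator_of_mem hx]
      exact (abs_sub _ _).trans (by linarith [hu1 (k n) x])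
    · simp [v, G, hx]
  have hvM : ∀ n ξ, IsTest Ω ξ → (∀ x, ‖ξ x‖ ≤ 1) → ∫ x in Ω, v n x * div ξ x ≤ 2 * M := by
    intro n ξ hξ hξ1
    obtain ⟨C, hC⟩ := hdivb ξ hξ
    have hmul : ∀ {g : Plane → ℝ}, IntegrableOn g Ω → IntegrableOn (fun x => g x * div ξ x) Ω :=
      fun hg => Integrable.mul_bdd hg (continuous_div hξ.contDiff).aestronglyMeasurable
        (Eventually.of_forall hC)
    have h1 : ∫ x in Ω, v n x * div ξ x
        = (∫ x in Ω, u (k n) x * div ξ x) - ∫ x in Ω, w x * div ξ x := by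
      rw [← integral_sub (hmul (hui _)) (hmul hw1)]
      refine setIntegral_congr_fun hΩ.measurableSet fun x hx => ?_
      simp only [v, indicator_of_mem hx, sub_mul]
    -- The field `-ξ` bounds the term of `w` from the other side; hence the constant `2 * M` for the
    -- difference.
    have h2 := hwM _ hξ.neg (fun x => by simpa using hξ1 x)
    simp only [div_neg, mul_neg, integral_neg] at h2
    have h3 := hM (k n) ξ hξ hξ1
    linarith
  have hvweak : ∀ (x : Plane) (r : ℝ),
      Tendsto (fun n => ∫ y in Metric.ball x r, v n y) atTop (𝓝 0) := by
    intro x r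
    let g : Plane → ℝ := (Metric.ball x r).indicator 1
    have hgm : Measurable g := measurable_one.indicator measurableSet_ball
    have hgb : ∀ y, ‖g y‖ ≤ 1 := fun y => by
      by_cases hy : y ∈ Metric.ball x r <;> simp [g, hy]
    have hg : MemLp g 2 (volume.restrict Ω) :=
      MemLp.of_bound hgm.aestronglyMeasurable 1 (Eventually.of_forall hgb)
    have hmul : ∀ {q : Plane → ℝ}, IntegrableOn q Ω → IntegrableOn (fun x => q x * g x) Ω :=
      fun hq => Integrable.mul_bdd hq hgm.aestronglyMeasurable (Eventually.of_forall hgb)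
    have e : ∀ n, ∫ y in Metric.ball x r, v n y
        = (∫ y in Ω, u (k n) y * g y) - ∫ y in Ω, w y * g y := by
      intro n
      rw [← integral_sub (hmul (hui _)) (hmul hw1), ← integral_indicator measurableSet_ball,
        ← integral_indicator hΩ.measurableSet]
      refine integral_congr_ae (Eventually.of_forall fun y => ?_)
      by_cases hy : y ∈ Metric.ball x r <;> by_cases hy' : y ∈ Ω <;>
        simp only [g, v, indicator_of_mem, indicator_of_notMem, hy, hy', not_false_eq_true,
          Pi.one_apply, mul_one, mul_zero, sub_self]
    simp only [e]
    simpa using (hweak g hg).sub_const (∫ y in Ω, w y * g y)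
  have hL1 : Tendsto (fun n => ∫⁻ x in Ω, ‖v n x‖ₑ) atTop (𝓝 0) := by
    refine ENNReal.tendsto_nhds_zero.2 fun ε hε => ?_
    have hGfin : ∫⁻ x, ‖G x‖ₑ ≠ ⊤ := hG.hasFiniteIntegral.ne
    obtain ⟨ε', hε', hsmall⟩ := exists_pos_setLIntegral_lt_of_measure_lt hGfin
      (ENNReal.half_pos hε.ne').ne'
    obtain ⟨K, hKΩ, hK, hKd⟩ := hΩ.measurableSet.exists_isCompact_sdiff_lt hfin hε'.ne'
    have hKlim := tendsto_setIntegral_abs_of_weak hΩ hvm hG hvG (by positivity) hvM hvweak hK hKΩ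
    have hKlim' := ENNReal.tendsto_ofReal hKlim
    rw [ENNReal.ofReal_zero] at hKlim'
    filter_upwards [ENNReal.tendsto_nhds_zero.1 hKlim' (ε / 2) (ENNReal.half_pos hε.ne')] with n hn
    have hvi : Integrable (v n) := hG.mono' (hvm n).aestronglyMeasurable
      (Eventually.of_forall (hvG n))
    calc ∫⁻ x in Ω, ‖v n x‖ₑ ≤ (∫⁻ x in K, ‖v n x‖ₑ) + ∫⁻ x in Ω \ K, ‖v n x‖ₑ := by
          refine le_trans (lintegral_mono_set ?_) (lintegral_union_le _ K (Ω \ K))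
          exact fun x hx => by by_cases h : x ∈ K <;> simp [h, hx]
      _ ≤ ε / 2 + ε / 2 := by
          refine add_le_add ?_ ?_
          · refine le_trans (le_of_eq ?_) hn
            exact (ofReal_integral_norm_eq_lintegral_enorm hvi.integrableOn).symm
          · refine le_trans (lintegral_mono fun x => ?_) (hsmall (Ω \ K) hKd).le
            refine enorm_le_iff_norm_le.2 ?_
            exact (hvG n x).trans (Real.le_norm_self _)
      _ = ε := ENNReal.add_halves ε
  have hmeas : TendstoInMeasure (volume.restrict Ω) v atTop (fun _ => 0) := by
    refine tendstoInMeasure_of_tendsto_eLpNorm (p := 1) one_ne_zero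
      (fun n => (hvm n).aestronglyMeasurable) aestronglyMeasurable_const ?_
    simpa [eLpNorm_one_eq_lintegral_enorm] using hL1
  obtain ⟨l, hl, hlim⟩ := hmeas.exists_seq_tendsto_ae
  -- Clamping puts the values in `[0,1]` at every point; where the sequence converges it changes
  -- nothing.
  refine ⟨fun x => max 0 (min 1 (w x)), k ∘ l, hk.comp hl,
    measurable_const.max (measurable_const.min hwm),
    fun x => ⟨le_max_left _ _, max_le zero_le_one (min_le_left _ _)⟩, ?_⟩
  filter_upwards [hlim, ae_restrict_mem hΩ.measurableSet] with x hx hxΩ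
  have h1 : Tendsto (fun n => u (k (l n)) x) atTop (𝓝 (w x)) := by
    have := hx.add_const (w x)
    simpa [v, indicator_of_mem hxΩ] using this
  have h2 : w x ∈ Icc (0 : ℝ) 1 :=
    isClosed_Icc.mem_of_tendsto h1 (Eventually.of_forall fun n => hu01 _ x)
  rw [min_eq_right h2.2, max_eq_right h2.1]
  exact h1

/-! ### Kantorovich duality on compact spaces -/

section Kantorovich

variable {X Y : Type*} [MetricSpace X] [CompactSpace X] [MeasurableSpace X] [BorelSpace X]
  [MetricSpace Y] [CompactSpace Y] [MeasurableSpace Y] [BorelSpace Y]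

lemma integrable_continuousMap (μ : Measure X) [IsFiniteMeasure μ] (h : C(X, ℝ)) :
    Integrable (fun x => h x) μ :=
  h.continuous.integrable_of_hasCompactSupport (HasCompactSupport.of_compactSpace _)

/-- A positive linear functional on `C(X × Y)` that extends `μ ⊗ ν` on sums `u(x) + v(y)` and is
bounded by the dual value on the functions below the cost. -/
lemma exists_functional (μ : Measure X) [IsProbabilityMeasure μ] (ν : Measure Y)
    [IsProbabilityMeasure ν] (c : X × Y → ℝ) {K : ℝ}
    (hK : ∀ (u : C(X, ℝ)) (v : C(Y, ℝ)), (∀ x y, u x + v y ≤ c (x, y)) →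
      ∫ x, u x ∂μ + ∫ y, v y ∂ν ≤ K) :
    ∃ L : C(X × Y, ℝ) →ₗ[ℝ] ℝ, (∀ h, 0 ≤ h → 0 ≤ L h) ∧ (∀ h : C(X × Y, ℝ), (∀ z, h z ≤ c z) →
      L h ≤ K) ∧ ∀ (h : C(X × Y, ℝ)) (u : C(X, ℝ)) (v : C(Y, ℝ)),
      (∀ x y, h (x, y) = u x + v y) → L h = ∫ x, u x ∂μ + ∫ y, v y ∂ν := by
  -- The cone of pairs `(h, t)` with `t ≥ 0` and `h ≤ t c`. The extra coordinate homogenises the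
  -- constraint `h ≤ c`, which alone does not define a cone.
  let s : PointedCone ℝ (C(X × Y, ℝ) × ℝ) :=
    { carrier := {q | 0 ≤ q.2 ∧ ∀ z, q.1 z ≤ q.2 * c z}
      add_mem' := by
        rintro p q ⟨hp1, hp2⟩ ⟨hq1, hq2⟩
        refine ⟨add_nonneg hp1 hq1, fun z => ?_⟩
        have := add_le_add (hp2 z) (hq2 z)
        simpa [add_mul] using this
      zero_mem' := ⟨le_rfl, fun z => by simp⟩
      smul_mem' := by
        rintro ⟨r, hr⟩ p ⟨hp1, hp2⟩
        refine ⟨mul_nonneg hr hp1, fun z => ?_⟩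
        have := mul_le_mul_of_nonneg_left (hp2 z) hr
        change r * p.1 z ≤ r * p.2 * c z
        rwa [mul_assoc] }
  -- The product measure gives a linear form on all pairs, so its restriction to sums `u(x) + v(y)`
  -- does not depend on how the sum is decomposed.
  let F : (C(X × Y, ℝ) × ℝ) →ₗ[ℝ] ℝ :=
    { toFun := fun q => q.2 * K - ∫ z, q.1 z ∂(μ.prod ν)
      map_add' := by
        intro p q
        have : ∫ z, (p + q).1 z ∂(μ.prod ν) = ∫ z, p.1 z ∂(μ.prod ν) + ∫ z, q.1 z ∂(μ.prod ν) :=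
          integral_add (integrable_continuousMap _ _) (integrable_continuousMap _ _)
        rw [this, Prod.snd_add]
        ring
      map_smul' := by
        intro r p
        have : ∫ z, (r • p).1 z ∂(μ.prod ν) = r * ∫ z, p.1 z ∂(μ.prod ν) :=
          integral_const_mul r _
        rw [this, Prod.smul_snd, smul_eq_mul, RingHom.id_apply, smul_eq_mul]
        ring }
  have hFsum : ∀ (q : C(X × Y, ℝ) × ℝ) (u : C(X, ℝ)) (v : C(Y, ℝ)),
      (∀ x y, q.1 (x, y) = u x + v y) → F q = q.2 * K - (∫ x, u x ∂μ + ∫ y, v y ∂ν) := by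
    intro q u v h
    change q.2 * K - _ = _
    congr 1
    have e : ∀ z : X × Y, q.1 z = u z.1 + v z.2 := fun z => h z.1 z.2
    simp_rw [e]
    rw [integral_add ((integrable_continuousMap μ u).comp_fst ν)
      ((integrable_continuousMap ν v).comp_snd μ), integral_fun_fst (fun x => u x),
      integral_fun_snd (fun y => v y)]
    simp
  let dom : Submodule ℝ (C(X × Y, ℝ) × ℝ) :=
    { carrier := {q | ∃ (u : C(X, ℝ)) (v : C(Y, ℝ)), ∀ x y, q.1 (x, y) = u x + v y}
      add_mem' := by
        rintro p q ⟨u, v, h⟩ ⟨u', v', h'⟩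
        refine ⟨u + u', v + v', fun x y => ?_⟩
        simp [h, h']
        ring
      zero_mem' := ⟨0, 0, by simp⟩
      smul_mem' := by
        rintro r p ⟨u, v, h⟩
        refine ⟨r • u, r • v, fun x y => ?_⟩
        simp [h, mul_add] }
  have hnonneg : ∀ q : dom, (q : C(X × Y, ℝ) × ℝ) ∈ s → 0 ≤ F.domRestrict dom q := by
    rintro ⟨q, u, v, huv⟩ ⟨hq0, hqc⟩
    change 0 ≤ F q
    -- At `t = 0` the constraint says `h ≤ 0`; for `t > 0`, dividing by `t` gives an admissible
    -- pair, to which `hK` applies.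
    rcases hq0.eq_or_lt with h0 | hpos
    · change 0 ≤ q.2 * K - _
      rw [← h0, zero_mul, zero_sub, neg_nonneg]
      refine integral_nonpos fun z => ?_
      have := hqc z
      rw [← h0, zero_mul] at this
      exact this
    · rw [hFsum q u v huv]
      have := hK (q.2⁻¹ • u) (q.2⁻¹ • v) fun x y => by
        have h1 := hqc (x, y)
        change q.1 (x, y) ≤ _ at h1
        rw [huv] at h1
        simp only [ContinuousMap.smul_apply, smul_eq_mul, ← mul_add]
        rw [inv_mul_le_iff₀ hpos]
        exact h1
      simp only [ContinuousMap.smul_apply, smul_eq_mul, integral_const_mul, ← mul_add] at this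
      rw [inv_mul_le_iff₀ hpos] at this
      linarith
  have hdense : ∀ q, ∃ p : dom, (p : C(X × Y, ℝ) × ℝ) + q ∈ s := by
    rintro ⟨h, r⟩
    refine ⟨⟨(ContinuousMap.const _ (-‖h‖), -r), ⟨ContinuousMap.const _ (-‖h‖), 0, by simp⟩⟩, ?_, ?_⟩
    · simp
    · intro z
      have := (Real.le_norm_self _).trans (h.norm_coe_le_norm z)
      simpa using this
  obtain ⟨g, hg, hgs⟩ := riesz_extension s ⟨dom, F.domRestrict dom⟩ hnonneg hdense
  -- With `L h = -g (h, 0)`, positivity of `L` comes from `(-h, 0)` in the cone, and the bound by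
  -- `K` from `(h, 1)` in the cone together with `g (0, 1) = K`.
  refine ⟨-(g ∘ₗ LinearMap.inl ℝ _ ℝ), fun h h0 => ?_, fun h hc => ?_, fun h u v huv => ?_⟩
  · have : 0 ≤ g (-h, 0) := hgs _ ⟨le_rfl, fun z => by simpa using h0 z⟩
    rw [show ((-h, 0) : C(X × Y, ℝ) × ℝ) = -(h, 0) by simp, map_neg] at this
    simpa using this
  · have h1 : 0 ≤ g (h, 1) := hgs _ ⟨zero_le_one, fun z => by simpa using hc z⟩
    have h2 : g (0, 1) = K := by
      rw [hg ⟨(0, 1), ⟨0, 0, by simp⟩⟩]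
      change F (0, 1) = K
      rw [hFsum _ 0 0 (by simp)]
      simp
    rw [show ((h, 1) : C(X × Y, ℝ) × ℝ) = (h, 0) + (0, 1) by simp, map_add, h2] at h1
    have : -g (h, 0) ≤ K := by linarith
    simpa using this
  · have h2 : g (h, 0) = F (h, 0) := hg ⟨(h, 0), ⟨u, v, huv⟩⟩
    rw [hFsum _ u v huv] at h2
    change -g (h, 0) = _
    rw [h2]
    simp

/-- The functional of `exists_functional` is represented by a measure through Riesz–Markov. Its
values on functions of one variable give the marginals, and a marginal gives the total mass. -/
lemma exists_plan (μ : Measure X) [IsProbabilityMeasure μ] (ν : Measure Y)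
    [IsProbabilityMeasure ν] (c : X × Y → ℝ) {K : ℝ}
    (hK : ∀ (u : C(X, ℝ)) (v : C(Y, ℝ)), (∀ x y, u x + v y ≤ c (x, y)) →
      ∫ x, u x ∂μ + ∫ y, v y ∂ν ≤ K) :
    ∃ π : Measure (X × Y), IsProbabilityMeasure π ∧ π.map Prod.fst = μ ∧ π.map Prod.snd = ν ∧
      ∀ h : C(X × Y, ℝ), (∀ z, h z ≤ c z) → ∫ z, h z ∂π ≤ K := by
  obtain ⟨L, hL0, hLc, hLsum⟩ := exists_functional μ ν c hK
  let Λ : C_c(X × Y, ℝ) →ₚ[ℝ] ℝ := PositiveLinearMap.mk₀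
    { toFun := fun h => L h.toContinuousMap
      map_add' := fun h h' => L.map_add h.toContinuousMap h'.toContinuousMap
      map_smul' := fun r h => L.map_smul r h.toContinuousMap } fun h h0 => hL0 _ h0
  let π : Measure (X × Y) := RealRMK.rieszMeasure Λ
  have hπ : ∀ h : C(X × Y, ℝ), ∫ z, h z ∂π = L h := fun h =>
    RealRMK.integral_rieszMeasure Λ ⟨h, HasCompactSupport.of_compactSpace _⟩
  have hfin : IsFiniteMeasure π := inferInstance
  have hmap1 : π.map Prod.fst = μ := by
    have : IsFiniteMeasure (π.map Prod.fst) := Measure.isFiniteMeasure_map _ _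
    refine ext_of_forall_integral_eq_of_IsFiniteMeasure fun u => ?_
    rw [integral_map measurable_fst.aemeasurable u.continuous.aestronglyMeasurable]
    have h1 := hπ (u.toContinuousMap.comp ⟨Prod.fst, continuous_fst⟩)
    rw [hLsum _ u.toContinuousMap 0 (by simp)] at h1
    simpa using h1
  have hmap2 : π.map Prod.snd = ν := by
    have : IsFiniteMeasure (π.map Prod.snd) := Measure.isFiniteMeasure_map _ _
    refine ext_of_forall_integral_eq_of_IsFiniteMeasure fun u => ?_
    rw [integral_map measurable_snd.aemeasurable u.continuous.aestronglyMeasurable]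
    have h1 := hπ (u.toContinuousMap.comp ⟨Prod.snd, continuous_snd⟩)
    rw [hLsum _ 0 u.toContinuousMap (by simp)] at h1
    simpa using h1
  refine ⟨π, ⟨?_⟩, hmap1, hmap2, fun h hc => (hπ h).trans_le (hLc h hc)⟩
  have : (π.map Prod.fst) univ = 1 := by rw [hmap1]; exact measure_univ
  rwa [Measure.map_apply measurable_fst MeasurableSet.univ, preimage_univ] at this

/-- The approximants are the Lipschitz regularisations `inf_w (c w + k dist z w)`. Near `z` lower
semicontinuity bounds `c w` from below; away from `z` the penalty outweighs the lower bound `m` for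
large `k`. -/
lemma exists_continuous_tendsto_of_lowerSemicontinuous {Z : Type*} [PseudoMetricSpace Z]
    {c : Z → ℝ} (hc : LowerSemicontinuous c) {m : ℝ} (hm : ∀ z, m ≤ c z) :
    ∃ d : ℕ → C(Z, ℝ), (∀ k z, m ≤ d k z) ∧ (∀ k z, d k z ≤ c z) ∧
      ∀ z, Tendsto (fun k => d k z) atTop (𝓝 (c z)) := by
  have hlow : ∀ (k : ℕ) (z w : Z), m ≤ c w + k * dist z w := fun k z w =>
    (hm w).trans (le_add_of_nonneg_right (by positivity))
  have hbdd : ∀ (k : ℕ) (z : Z), BddBelow (range fun w => c w + k * dist z w) := fun k z =>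
    ⟨m, by rintro _ ⟨w, rfl⟩; exact hlow k z w⟩
  let d : ℕ → Z → ℝ := fun k z => ⨅ w, (c w + k * dist z w)
  have hdc : ∀ k z, d k z ≤ c z := fun k z => (ciInf_le (hbdd k z) z).trans (by simp)
  have hmd : ∀ k z, m ≤ d k z := fun k z =>
    haveI : Nonempty Z := ⟨z⟩
    le_ciInf (hlow k z)
  have hlip : ∀ k : ℕ, LipschitzWith (k : NNReal) (d k) := by
    intro k
    refine LipschitzWith.of_le_add_mul _ fun z z' => ?_
    have : Nonempty Z := ⟨z⟩
    rw [← sub_le_iff_le_add]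
    refine le_ciInf fun w => ?_
    rw [sub_le_iff_le_add]
    refine (ciInf_le (hbdd k z) w).trans ?_
    have h1 := mul_le_mul_of_nonneg_left (dist_triangle z z' w) (Nat.cast_nonneg (α := ℝ) k)
    simp only [NNReal.coe_natCast]
    linarith
  refine ⟨fun k => ⟨d k, (hlip k).continuous⟩, hmd, hdc, fun z => ?_⟩
  refine tendsto_order.2 ⟨fun a ha => ?_, fun a ha => Eventually.of_forall fun k =>
    (hdc k z).trans_lt ha⟩
  obtain ⟨a', haa', ha'⟩ := exists_between ha
  obtain ⟨ε, hε, hball⟩ := Metric.eventually_nhds_iff.1 (hc z a' ha')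
  obtain ⟨N, hN⟩ := exists_nat_gt ((a' - m) / ε)
  filter_upwards [eventually_ge_atTop N] with k hk
  refine haa'.trans_le ?_
  have : Nonempty Z := ⟨z⟩
  refine le_ciInf fun w => ?_
  by_cases hw : dist w z < ε
  · exact (hball hw).le.trans (le_add_of_nonneg_right (by positivity))
  · have h1 : ε ≤ dist z w := by rw [dist_comm]; exact not_lt.1 hw
    have h2 : (a' - m) < N * ε := (div_lt_iff₀ hε).1 hN
    have h3 : (N : ℝ) * ε ≤ k * dist z w :=
      mul_le_mul (by exact_mod_cast hk) h1 hε.le (by positivity)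
    linarith [hm w]

/-- Fatou's lemma along continuous functions increasing no higher than `c`; subtracting `m` makes
the integrands nonnegative. -/
lemma lintegral_cost_le {Z : Type*} [PseudoMetricSpace Z] [MeasurableSpace Z] [BorelSpace Z]
    [CompactSpace Z]
    (π : Measure Z) [IsProbabilityMeasure π] {c : Z → ℝ} (hc : LowerSemicontinuous c) {m K : ℝ}
    (hm : ∀ z, m ≤ c z) (hK : ∀ h : C(Z, ℝ), (∀ z, h z ≤ c z) → ∫ z, h z ∂π ≤ K) :
    ∫⁻ z, ENNReal.ofReal (c z - m) ∂π ≤ ENNReal.ofReal (K - m) := by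
  obtain ⟨d, hmd, hdc, hlim⟩ := exists_continuous_tendsto_of_lowerSemicontinuous hc hm
  have hInt : ∀ k, Integrable (fun z => d k z) π := fun k =>
    (d k).continuous.integrable_of_hasCompactSupport (HasCompactSupport.of_compactSpace _)
  calc ∫⁻ z, ENNReal.ofReal (c z - m) ∂π
      = ∫⁻ z, liminf (fun k => ENNReal.ofReal (d k z - m)) atTop ∂π := by
        refine lintegral_congr fun z => ?_
        exact (ENNReal.tendsto_ofReal ((hlim z).sub_const m)).liminf_eq.symm
    _ ≤ liminf (fun k => ∫⁻ z, ENNReal.ofReal (d k z - m) ∂π) atTop :=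
        lintegral_liminf_le fun k => ((d k).continuous.measurable.sub_const m).ennreal_ofReal
    _ ≤ ENNReal.ofReal (K - m) := by
        refine liminf_le_of_le (by isBoundedDefault) fun b hb => ?_
        obtain ⟨k, hk⟩ := hb.exists
        refine hk.trans ?_
        have hsub : Integrable (fun z => d k z - m) π := (hInt k).sub (integrable_const m)
        rw [← ofReal_integral_eq_lintegral_ofReal hsub
          (Eventually.of_forall fun z => sub_nonneg.2 (hmd k z)),
          integral_sub (hInt k) (integrable_const m)]
        refine ENNReal.ofReal_le_ofReal ?_
        simpa using hK (d k) (hdc k)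

/-- The easy half of duality, without integrability of `a` or `b`. The pointwise inequality is
rearranged into positive and negative parts, so that everything is integrated in `[0, ∞]`. -/
lemma extIntegral_add_le {X Y : Type*} [MeasurableSpace X] [MeasurableSpace Y]
    {π : Measure (X × Y)} [IsProbabilityMeasure π] {c : X × Y → ℝ} {m K : ℝ} (hmK : m ≤ K)
    (hm : ∀ z, m ≤ c z)
    (hcK : ∫⁻ z, ENNReal.ofReal (c z - m) ∂π ≤ ENNReal.ofReal (K - m))
    {a : X → ℝ} {b : Y → ℝ} (ha : Measurable a) (hb : Measurable b)
    (hab : ∀ x y, a x + b y ≤ c (x, y)) :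
    extIntegral (π.map Prod.fst) a + extIntegral (π.map Prod.snd) b ≤ (K : EReal) := by
  have e1 : ∀ {k : X → ℝ}, Measurable k → ∫⁻ x, ENNReal.ofReal (k x) ∂(π.map Prod.fst)
      = ∫⁻ z, ENNReal.ofReal (k z.1) ∂π := fun hk =>
    lintegral_map hk.ennreal_ofReal measurable_fst
  have e2 : ∀ {k : Y → ℝ}, Measurable k → ∫⁻ x, ENNReal.ofReal (k x) ∂(π.map Prod.snd)
      = ∫⁻ z, ENNReal.ofReal (k z.2) ∂π := fun hk =>
    lintegral_map hk.ennreal_ofReal measurable_snd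
  simp only [extIntegral]
  rw [e1 ha, e1 (k := fun x => -a x) ha.neg, e2 hb, e2 (k := fun x => -b x) hb.neg]
  have m1 : Measurable fun z : X × Y => ENNReal.ofReal (a z.1) :=
    (ha.comp measurable_fst).ennreal_ofReal
  have m2 : Measurable fun z : X × Y => ENNReal.ofReal (b z.2) :=
    (hb.comp measurable_snd).ennreal_ofReal
  have m3 : Measurable fun z : X × Y => ENNReal.ofReal (-a z.1) :=
    (ha.comp measurable_fst).neg.ennreal_ofReal
  have m4 : Measurable fun z : X × Y => ENNReal.ofReal (-b z.2) :=
    (hb.comp measurable_snd).neg.ennreal_ofReal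
  set P := ∫⁻ z, ENNReal.ofReal (a z.1) ∂π
  set P' := ∫⁻ z, ENNReal.ofReal (b z.2) ∂π
  set N := ∫⁻ z, ENNReal.ofReal (-a z.1) ∂π
  set N' := ∫⁻ z, ENNReal.ofReal (-b z.2) ∂π
  have hmain : P + P' + ENNReal.ofReal (-m) ≤ ENNReal.ofReal (K - m) + N + N' + ENNReal.ofReal m := by
    calc P + P' + ENNReal.ofReal (-m)
        = ∫⁻ z, (ENNReal.ofReal (a z.1) + ENNReal.ofReal (b z.2) + ENNReal.ofReal (-m)) ∂π := by
          rw [lintegral_add_right _ measurable_const, lintegral_add_left m1]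
          simp [P, P']
      _ ≤ ∫⁻ z, (ENNReal.ofReal (c z - m) + ENNReal.ofReal (-a z.1) + ENNReal.ofReal (-b z.2)
            + ENNReal.ofReal m) ∂π := by
          refine lintegral_mono fun z => ?_
          have hz := hab z.1 z.2
          have hmz := hm z
          have hmax : ∀ t : ℝ, ENNReal.ofReal t = ENNReal.ofReal (max t 0) := fun t => by
            rw [ENNReal.ofReal_max, ENNReal.ofReal_zero, max_eq_left zero_le]
          rw [hmax (a z.1), hmax (b z.2), hmax (-m), hmax (-a z.1), hmax (-b z.2), hmax m,
            ← ENNReal.ofReal_add (by positivity) (by positivity),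
            ← ENNReal.ofReal_add (by positivity) (by positivity),
            ← ENNReal.ofReal_add (sub_nonneg.2 hmz) (by positivity),
            ← ENNReal.ofReal_add (add_nonneg (sub_nonneg.2 hmz) (by positivity)) (by positivity),
            ← ENNReal.ofReal_add
              (add_nonneg (add_nonneg (sub_nonneg.2 hmz) (by positivity)) (by positivity))
              (by positivity)]
          refine ENNReal.ofReal_le_ofReal ?_
          have h1 := max_zero_sub_max_neg_zero_eq_self (a z.1)
          have h2 := max_zero_sub_max_neg_zero_eq_self (b z.2)
          have h3 := max_zero_sub_max_neg_zero_eq_self m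
          linarith
      _ = (∫⁻ z, ENNReal.ofReal (c z - m) ∂π) + N + N' + ENNReal.ofReal m := by
          rw [lintegral_add_right _ measurable_const, lintegral_add_right _ m4,
            lintegral_add_right _ m3]
          simp [N, N']
      _ ≤ _ := by gcongr
  -- If a negative part is infinite, the convention `⊤ + ⊥ = ⊥` makes the left side `-∞`. Otherwise
  -- `hmain` forces the positive parts to be finite too and the rest is real arithmetic.
  by_cases hN : N = ⊤
  · rw [hN]; simp
  by_cases hN' : N' = ⊤
  · rw [hN']; simp
  have hrhs : ENNReal.ofReal (K - m) + N + N' + ENNReal.ofReal m ≠ ⊤ := by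
    simp [hN, hN']
  have hlhs : P + P' + ENNReal.ofReal (-m) ≠ ⊤ := ne_top_of_le_ne_top hrhs hmain
  have hP : P ≠ ⊤ := fun h => hlhs (by simp [h])
  have hP' : P' ≠ ⊤ := fun h => hlhs (by simp [h])
  have hreal := ENNReal.toReal_mono hrhs hmain
  rw [ENNReal.toReal_add (by simp [hP, hP']) (by simp), ENNReal.toReal_add hP hP',
    ENNReal.toReal_add (by simp [hN, hN']) (by simp), ENNReal.toReal_add (by simp [hN]) hN',
    ENNReal.toReal_add (by simp) hN, ENNReal.toReal_ofReal (sub_nonneg.2 hmK)] at hreal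
  have hmm : (ENNReal.ofReal m).toReal - (ENNReal.ofReal (-m)).toReal = m := by
    simp only [ENNReal.toReal_ofReal']
    rcases le_total 0 m with h | h
    · rw [max_eq_left h, max_eq_right (by linarith)]; ring
    · rw [max_eq_right h, max_eq_left (by linarith)]; ring
  rw [← EReal.coe_ennreal_toReal hP, ← EReal.coe_ennreal_toReal hN,
    ← EReal.coe_ennreal_toReal hP', ← EReal.coe_ennreal_toReal hN']
  norm_cast
  linarith

end Kantorovich

/-! ### Duality for measures on the line carried by `[0,1]` -/

lemma extIntegral_map_projIcc {μ : Measure ℝ} (hμ : μ (Icc (0 : ℝ) 1)ᶜ = 0) {ψ : ℝ → ℝ}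
    (hψ : Measurable ψ) :
    extIntegral (μ.map (projIcc (0 : ℝ) 1 zero_le_one)) (fun x => ψ x) = extIntegral μ ψ := by
  have hproj : Measurable (projIcc (0 : ℝ) 1 zero_le_one) := continuous_projIcc.measurable
  have key : ∀ {χ : ℝ → ℝ}, Measurable χ →
      ∫⁻ x, ENNReal.ofReal (χ x) ∂(μ.map (projIcc (0 : ℝ) 1 zero_le_one))
        = ∫⁻ t, ENNReal.ofReal (χ t) ∂μ := by
    intro χ hχ
    have hm : Measurable fun x : Icc (0 : ℝ) 1 => ENNReal.ofReal (χ x) :=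
      (hχ.comp measurable_subtype_coe).ennreal_ofReal
    rw [lintegral_map hm hproj]
    refine lintegral_congr_ae ?_
    filter_upwards [compl_mem_ae_iff.2 hμ] with t ht
    rw [compl_compl] at ht
    rw [projIcc_of_mem zero_le_one ht]
  rw [extIntegral, extIntegral, key hψ, key (χ := fun t => -ψ t) hψ.neg]

/-- A bound on continuous pairs yields a plan of cost at most `K`, and a plan bounds all Borel
pairs. This passage from continuous to Borel potentials lets the energy of the limit be tested on
continuous ones only. -/
lemma extIntegral_dual_le {c : ℝ → ℝ → ℝ}
    (hc : LowerSemicontinuousOn (fun q : ℝ × ℝ => c q.1 q.2) (Icc (0 : ℝ) 1 ×ˢ Icc (0 : ℝ) 1))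
    {μ μ₀ : Measure ℝ} [IsProbabilityMeasure μ] [IsProbabilityMeasure μ₀]
    (hμ : μ (Icc (0 : ℝ) 1)ᶜ = 0) (hμ₀ : μ₀ (Icc (0 : ℝ) 1)ᶜ = 0) {K : ℝ}
    (hK : ∀ ψ ψ' : ℝ → ℝ, Continuous ψ → Continuous ψ' →
      (∀ γ₁ ∈ Icc (0 : ℝ) 1, ∀ γ₂ ∈ Icc (0 : ℝ) 1, ψ γ₁ - ψ' γ₂ ≤ c γ₁ γ₂) →
      ∫ t, ψ t ∂μ - ∫ t, ψ' t ∂μ₀ ≤ K)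
    {ψ ψ' : ℝ → ℝ} (hψ : Measurable ψ) (hψ' : Measurable ψ')
    (hψc : ∀ γ₁ ∈ Icc (0 : ℝ) 1, ∀ γ₂ ∈ Icc (0 : ℝ) 1, ψ γ₁ - ψ' γ₂ ≤ c γ₁ γ₂) :
    extIntegral μ ψ + extIntegral μ₀ (fun t => -ψ' t) ≤ (K : EReal) := by
  let I := Icc (0 : ℝ) 1
  let pr : ℝ → I := projIcc (0 : ℝ) 1 zero_le_one
  have hpr : Measurable pr := continuous_projIcc.measurable
  let μI : Measure I := μ.map pr
  let νI : Measure I := μ₀.map pr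
  have : IsProbabilityMeasure μI := Measure.isProbabilityMeasure_map hpr.aemeasurable
  have : IsProbabilityMeasure νI := Measure.isProbabilityMeasure_map hpr.aemeasurable
  let c' : I × I → ℝ := fun z => c z.1 z.2
  have hc' : LowerSemicontinuous c' := by
    intro z y hy
    have hcont : Continuous fun z : I × I => ((z.1 : ℝ), (z.2 : ℝ)) := by fun_prop
    have ht : Tendsto (fun z : I × I => ((z.1 : ℝ), (z.2 : ℝ))) (𝓝 z)
        (𝓝[Icc (0 : ℝ) 1 ×ˢ Icc (0 : ℝ) 1] ((z.1 : ℝ), (z.2 : ℝ))) :=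
      tendsto_nhdsWithin_iff.2 ⟨hcont.tendsto z, Eventually.of_forall fun w => ⟨w.1.2, w.2.2⟩⟩
    exact ht.eventually (hc ((z.1 : ℝ), (z.2 : ℝ)) ⟨z.1.2, z.2.2⟩ y hy)
  obtain ⟨m, hm⟩ : ∃ m, ∀ z, m ≤ c' z := by
    have hne : (univ : Set (I × I)).Nonempty := ⟨(⟨0, by simp [I]⟩, ⟨0, by simp [I]⟩), mem_univ _⟩
    obtain ⟨z₀, -, hz₀⟩ := LowerSemicontinuousOn.exists_isMinOn hne isCompact_univ
      (lowerSemicontinuousOn_univ_iff.2 hc')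
    exact ⟨c' z₀, fun z => hz₀ (mem_univ z)⟩
  -- The constant pair `(m, 0)` is admissible and has value `m`.
  have hmK : m ≤ K := by
    have := hK (fun _ => m) (fun _ => 0) continuous_const continuous_const
      fun s hs t ht => by simpa using hm (⟨s, hs⟩, ⟨t, ht⟩)
    simpa using this
  obtain ⟨π, hπ, h1, h2, hπK⟩ := exists_plan μI νI c' (K := K) fun u v huv => by
    have hu : Continuous fun t : ℝ => u (pr t) := u.continuous.comp continuous_projIcc
    have hv : Continuous fun t : ℝ => v (pr t) := v.continuous.comp continuous_projIcc
    -- Potentials on the interval extend continuously to the line through the projection; the sign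
    -- of the second one changes between the two conventions.
    have := hK (fun t => u (pr t)) (fun t => -v (pr t)) hu hv.neg fun s hs t ht => by
      have h := huv (pr s) (pr t)
      simp only [c', pr, projIcc_of_mem zero_le_one hs, projIcc_of_mem zero_le_one ht] at h ⊢
      linarith
    rw [integral_neg, sub_neg_eq_add] at this
    rw [integral_map hpr.aemeasurable u.continuous.aestronglyMeasurable,
      integral_map hpr.aemeasurable v.continuous.aestronglyMeasurable]
    exact this
  have hcK := lintegral_cost_le π hc' hm hπK
  have := extIntegral_add_le hmK hm hcK (a := fun x => ψ x) (b := fun y => -ψ' y)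
    (hψ.comp measurable_subtype_coe) (hψ'.comp measurable_subtype_coe).neg
    fun x y => by simpa [sub_eq_add_neg] using hψc x x.2 y y.2
  rw [h1, h2] at this
  rwa [extIntegral_map_projIcc hμ hψ,
    extIntegral_map_projIcc hμ₀ (ψ := fun t => -ψ' t) hψ'.neg] at this

/-! ### Extended integrals and the variation of level sets -/

/-- An integrable minorant keeps the negative part finite. The integral then splits into an element
of `[0, ∞]`, to which Fatou's lemma applies, and a real constant. -/
lemma extIntegral_eq_lintegral_sub_add {α : Type*} [MeasurableSpace α] {μ : Measure α}
    {h g : α → ℝ} (hh : AEMeasurable h μ) (hg : Integrable g μ) (hgh : ∀ᵐ x ∂μ, g x ≤ h x) :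
    extIntegral μ h = ((∫⁻ x, ENNReal.ofReal (h x - g x) ∂μ : ENNReal) : EReal)
      + ((∫ x, g x ∂μ : ℝ) : EReal) := by
  have m1 : AEMeasurable (fun x => ENNReal.ofReal (h x)) μ := hh.ennreal_ofReal
  have m2 : AEMeasurable (fun x => ENNReal.ofReal (-h x)) μ := hh.neg.ennreal_ofReal
  have m4 : AEMeasurable (fun x => ENNReal.ofReal (g x)) μ := hg.aemeasurable.ennreal_ofReal
  have f3 : ∫⁻ x, ENNReal.ofReal (-g x) ∂μ ≠ ⊤ := hg.neg.lintegral_lt_top.ne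
  have f4 : ∫⁻ x, ENNReal.ofReal (g x) ∂μ ≠ ⊤ := hg.lintegral_lt_top.ne
  have f2 : ∫⁻ x, ENNReal.ofReal (-h x) ∂μ ≠ ⊤ := by
    refine ne_top_of_le_ne_top f3 (lintegral_mono_ae ?_)
    filter_upwards [hgh] with x hx
    exact ENNReal.ofReal_le_ofReal (neg_le_neg hx)
  have hsum : (∫⁻ x, ENNReal.ofReal (h x) ∂μ) + ∫⁻ x, ENNReal.ofReal (-g x) ∂μ
      = (∫⁻ x, ENNReal.ofReal (h x - g x) ∂μ) + (∫⁻ x, ENNReal.ofReal (g x) ∂μ)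
        + ∫⁻ x, ENNReal.ofReal (-h x) ∂μ := by
    rw [← lintegral_add_left' m1, ← lintegral_add_right' _ m4, ← lintegral_add_right' _ m2]
    refine lintegral_congr_ae ?_
    filter_upwards [hgh] with x hx
    have hmax : ∀ t : ℝ, ENNReal.ofReal t = ENNReal.ofReal (max t 0) := fun t => by
      rw [ENNReal.ofReal_max, ENNReal.ofReal_zero, max_eq_left zero_le]
    rw [hmax (h x), hmax (-g x), hmax (g x), hmax (-h x),
      ← ENNReal.ofReal_add (by positivity) (by positivity),
      ← ENNReal.ofReal_add (sub_nonneg.2 hx) (by positivity),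
      ← ENNReal.ofReal_add (add_nonneg (sub_nonneg.2 hx) (by positivity)) (by positivity)]
    congr 1
    have h1 := max_zero_sub_max_neg_zero_eq_self (h x)
    have h2 := max_zero_sub_max_neg_zero_eq_self (g x)
    linarith
  rw [extIntegral, integral_eq_lintegral_pos_part_sub_lintegral_neg_part hg]
  set P := ∫⁻ x, ENNReal.ofReal (h x) ∂μ
  set N := ∫⁻ x, ENNReal.ofReal (-h x) ∂μ
  set D := ∫⁻ x, ENNReal.ofReal (h x - g x) ∂μ
  set A := ∫⁻ x, ENNReal.ofReal (g x) ∂μ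
  set B := ∫⁻ x, ENNReal.ofReal (-g x) ∂μ
  by_cases hD : D = ⊤
  · have hP : P = ⊤ := by
      by_contra hP
      have : P + B ≠ ⊤ := by simp [hP, f3]
      rw [hsum, hD] at this
      simp at this
    rw [hD, hP, ← EReal.coe_ennreal_toReal f2]
    rw [EReal.coe_ennreal_top, EReal.top_sub_coe, EReal.top_add_coe]
  · have hP : P ≠ ⊤ := by
      intro hP
      have : D + A + N ≠ ⊤ := by simp [hD, f4, f2]
      rw [← hsum, hP] at this
      simp at this
    have hr := congrArg ENNReal.toReal hsum
    rw [ENNReal.toReal_add hP f3, ENNReal.toReal_add (by simp [hD, f4]) f2,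
      ENNReal.toReal_add hD f4] at hr
    rw [← EReal.coe_ennreal_toReal hP, ← EReal.coe_ennreal_toReal f2,
      ← EReal.coe_ennreal_toReal hD]
    norm_cast
    linarith

lemma TV_congr_ae {Ω : Set Plane} {u v : Plane → ℝ} (h : u =ᵐ[volume.restrict Ω] v) :
    TV Ω u = TV Ω v := by
  unfold TV
  refine iSup_congr fun ξ => iSup_congr fun _ => iSup_congr fun _ => ?_
  congr 1
  refine integral_congr_ae ?_
  filter_upwards [h] with x hx
  rw [hx]

lemma lintegral_TV_congr {Ω : Set Plane} {φ φ' : Plane × ℝ → ℝ}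
    (h : φ =ᵐ[volume.restrict (Ω ×ˢ (univ : Set ℝ))] φ') (s : Set ℝ) :
    ∫⁻ γ in s, TV Ω (fun x => φ (x, γ)) = ∫⁻ γ in s, TV Ω (fun x => φ' (x, γ)) := by
  rw [Measure.volume_eq_prod, ← Measure.prod_restrict, Measure.restrict_univ,
    ← Measure.prod_swap] at h
  have h' := ae_of_ae_map measurable_swap.aemeasurable h
  refine lintegral_congr_ae (ae_restrict_of_ae ?_)
  filter_upwards [Measure.ae_ae_of_ae_prod h'] with γ hγ
  exact TV_congr_ae hγ

/-- The variation is a supremum over uncountably many fields. As functions on the separable space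
`L²(Ω)` the competing terms are continuous, so a countable subfamily has the same supremum; each of
its members is measurable in `γ` by Fubini. -/
lemma measurable_TV_subgraphFn {Ω : Set Plane} (hfin : volume Ω ≠ ⊤) {u : Plane → ℝ}
    (hu : Measurable u) : Measurable fun γ => TV Ω (fun x => subgraphFn u (x, γ)) := by
  have : IsFiniteMeasure (volume.restrict Ω) := isFiniteMeasure_restrict.2 hfin
  have : Fact ((2 : ENNReal) ≠ ⊤) := ⟨by simp⟩
  have hm := measurable_subgraphFn hu
  have hmem : ∀ γ, MemLp (fun x => subgraphFn u (x, γ)) 2 (volume.restrict Ω) := fun γ =>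
    MemLp.of_bound (hm.comp measurable_prodMk_right).aestronglyMeasurable 1
      (Eventually.of_forall fun x => norm_subgraphFn_le u _)
  let H := Lp ℝ 2 (volume.restrict Ω)
  let val : (Plane → Plane) → H → ENNReal := fun ξ v =>
    ENNReal.ofReal (∫ x in Ω, v x * div ξ x)
  let 𝓕 : Set (H → ENNReal) := {F | ∃ ξ, IsTest Ω ξ ∧ (∀ x, ‖ξ x‖ ≤ 1) ∧ F = val ξ}
  have hcont : ∀ F ∈ 𝓕, LowerSemicontinuous F := by
    rintro F ⟨ξ, hξ, -, rfl⟩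
    have hdiv : MemLp (div ξ) 2 (volume.restrict Ω) :=
      ((continuous_div hξ.contDiff).memLp_of_hasCompactSupport
        (hasCompactSupport_div hξ.hasCompactSupport)).restrict Ω
    have e : (fun v : H => ∫ x in Ω, v x * div ξ x) = fun v : H => inner ℝ (hdiv.toLp _) v := by
      ext v
      rw [L2.inner_def]
      refine integral_congr_ae ?_
      filter_upwards [hdiv.coeFn_toLp] with x hx
      rw [hx]
      simp
    refine Continuous.lowerSemicontinuous (ENNReal.continuous_ofReal.comp ?_)
    rw [e]
    fun_prop
  obtain ⟨𝓕', hsub, hcount, hlub⟩ :=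
    exists_countable_lowerSemicontinuous_isLUB hcont (isLUB_sSup 𝓕)
  have hval : ∀ ξ γ, val ξ ((hmem γ).toLp _)
      = ENNReal.ofReal (∫ x in Ω, subgraphFn u (x, γ) * div ξ x) := by
    intro ξ γ
    simp only [val]
    congr 1
    refine integral_congr_ae ?_
    filter_upwards [(hmem γ).coeFn_toLp] with x hx
    rw [hx]
  have key : ∀ γ, TV Ω (fun x => subgraphFn u (x, γ)) = ⨆ F ∈ 𝓕', F ((hmem γ).toLp _) := by
    intro γ
    have h1 : sSup 𝓕 ((hmem γ).toLp _) = ⨆ F ∈ 𝓕', F ((hmem γ).toLp _) := by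
      rw [← hlub.sSup_eq, sSup_apply, iSup_subtype]
    rw [← h1, sSup_apply]
    refine le_antisymm ?_ ?_
    · refine iSup_le fun ξ => iSup_le fun hξ => iSup_le fun hξ1 => ?_
      rw [← hval]
      exact le_iSup (fun F : 𝓕 => (F : H → ENNReal) ((hmem γ).toLp _)) ⟨val ξ, ξ, hξ, hξ1, rfl⟩
    · refine iSup_le ?_
      rintro ⟨F, ξ, hξ, hξ1, rfl⟩
      simp only [hval]
      exact le_iSup_of_le ξ (le_iSup_of_le hξ (le_iSup_of_le hξ1 le_rfl))
  simp only [key]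
  refine Measurable.biSup _ hcount fun F hF => ?_
  obtain ⟨ξ, hξ, -, rfl⟩ := hsub hF
  simp only [hval]
  refine Measurable.ennreal_ofReal ?_
  have hmm : Measurable (Function.uncurry fun (x : Plane) (γ : ℝ) =>
      subgraphFn u (x, γ) * div ξ x) :=
    hm.mul ((continuous_div hξ.contDiff).measurable.comp measurable_fst)
  exact (hmm.stronglyMeasurable.integral_prod_left' (μ := volume.restrict Ω)).measurable

lemma integral_subgraphFn {u : Plane → ℝ} (hu01 : ∀ x, u x ∈ Icc (0 : ℝ) 1) (x : Plane) :
    ∫ γ in Icc (0 : ℝ) 1, subgraphFn u (x, γ) = u x := by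
  have e : ∀ γ, subgraphFn u (x, γ) = (Iio (u x)).indicator (fun _ => (1 : ℝ)) γ := by
    intro γ
    by_cases h : γ < u x <;> simp [subgraphFn, indicator, h]
  simp_rw [e]
  rw [setIntegral_indicator measurableSet_Iio, setIntegral_const]
  have : Icc (0 : ℝ) 1 ∩ Iio (u x) = Ico 0 (u x) := by
    ext t
    simp only [mem_inter_iff, mem_Icc, mem_Iio, mem_Ico]
    exact ⟨fun h => ⟨h.1.1, h.2⟩, fun h => ⟨⟨h.1, h.2.le.trans (hu01 x).2⟩, h.2⟩⟩
  rw [this]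
  simp [(hu01 x).1]

/-- One half of the coarea formula: `u` is the integral over `γ` of the indicators of `{u > γ}`, so
its pairing with a divergence is at most the integrated variation of those indicators. -/
lemma setIntegral_mul_div_le {Ω : Set Plane} {u : Plane → ℝ}
    (hu : Measurable u) (hu01 : ∀ x, u x ∈ Icc (0 : ℝ) 1) {M : ℝ} (hM0 : 0 ≤ M)
    (hT : ∫⁻ γ in Icc (0 : ℝ) 1, TV Ω (fun x => subgraphFn u (x, γ)) ≤ ENNReal.ofReal M)
    {ξ : Plane → Plane} (hξ : IsTest Ω ξ) (hξ1 : ∀ x, ‖ξ x‖ ≤ 1) :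
    ∫ x in Ω, u x * div ξ x ≤ M := by
  have hm := measurable_subgraphFn hu
  have hInt : Integrable (fun q : Plane × ℝ => subgraphFn u q * div ξ q.1)
      ((volume.restrict Ω).prod (volume.restrict (Icc (0 : ℝ) 1))) :=
    (((integrable_div hξ).restrict (s := Ω)).comp_fst _).bdd_mul hm.aestronglyMeasurable
      (Eventually.of_forall (norm_subgraphFn_le u))
  have e : ∫ x in Ω, u x * div ξ x
      = ∫ γ in Icc (0 : ℝ) 1, ∫ x in Ω, subgraphFn u (x, γ) * div ξ x := by
    rw [← integral_integral_swap hInt]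
    refine integral_congr_ae (Eventually.of_forall fun x => ?_)
    simp only [integral_mul_const, integral_subgraphFn hu01]
  rw [e]
  refine (ENNReal.ofReal_le_ofReal_iff hM0).1 (le_trans ?_ hT)
  refine (ofReal_integral_le_lintegral hInt.integral_prod_right).trans ?_
  exact lintegral_mono fun γ => le_iSup_of_le ξ (le_iSup_of_le hξ (le_iSup_of_le hξ1 le_rfl))

/-- For all but countably many `γ` the level set `{w = γ}` is null in `Ω`, and then the indicators
of `{u n > γ}` converge a.e. The variation is lower semicontinuous at each such level, and Fatou's
lemma integrates this over `γ`. -/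
lemma lintegral_TV_le_liminf {Ω : Set Plane} (hfin : volume Ω ≠ ⊤) {u : ℕ → Plane → ℝ}
    (hu : ∀ n, Measurable (u n)) {w : Plane → ℝ} (hw : Measurable w)
    (hlim : ∀ᵐ x ∂(volume.restrict Ω), Tendsto (fun n => u n x) atTop (𝓝 (w x))) :
    ∫⁻ γ in Icc (0 : ℝ) 1, TV Ω (fun x => subgraphFn w (x, γ)) ≤
      liminf (fun n => ∫⁻ γ in Icc (0 : ℝ) 1, TV Ω (fun x => subgraphFn (u n) (x, γ))) atTop := by
  have : IsFiniteMeasure (volume.restrict Ω) := isFiniteMeasure_restrict.2 hfin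
  have hcount := Measure.countable_meas_level_set_pos (μ := volume.restrict Ω) hw
  have hae : ∀ᵐ γ : ℝ, TV Ω (fun x => subgraphFn w (x, γ)) ≤
      liminf (fun n => TV Ω (fun x => subgraphFn (u n) (x, γ))) atTop := by
    filter_upwards [compl_mem_ae_iff.2 (hcount.measure_zero volume)] with γ hγ
    have h0 : ∀ᵐ x ∂(volume.restrict Ω), w x ≠ γ := by
      have : (volume.restrict Ω) {x | w x = γ} = 0 := by simpa using hγ
      rw [ae_iff]
      simpa using this
    refine iSup_le fun ξ => iSup_le fun hξ => iSup_le fun hξ1 => ?_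
    have hconv : Tendsto (fun n => ∫ x in Ω, subgraphFn (u n) (x, γ) * div ξ x) atTop
        (𝓝 (∫ x in Ω, subgraphFn w (x, γ) * div ξ x)) := by
      refine tendsto_integral_of_dominated_convergence (fun x => |div ξ x|) (fun n => ?_)
        (integrable_div hξ).abs.restrict (fun n => Eventually.of_forall fun x => ?_) ?_
      · exact (((measurable_subgraphFn (hu n)).comp measurable_prodMk_right).mul
          (continuous_div hξ.contDiff).measurable).aestronglyMeasurable
      · rw [norm_mul]
        exact mul_le_of_le_one_left (abs_nonneg _) (norm_subgraphFn_le _ _)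
      · filter_upwards [hlim, h0] with x hx hne
        refine Tendsto.mul_const _ (tendsto_const_nhds.congr' ?_)
        rcases lt_or_gt_of_ne hne with h | h
        · filter_upwards [hx.eventually_lt_const h] with n hn
          rw [subgraphFn_of_le h.le, subgraphFn_of_le hn.le]
        · filter_upwards [hx.eventually_const_lt h] with n hn
          rw [subgraphFn_of_lt h, subgraphFn_of_lt hn]
    rw [← (ENNReal.tendsto_ofReal hconv).liminf_eq]
    refine liminf_le_liminf (Eventually.of_forall fun n => ?_)
    exact le_iSup_of_le ξ (le_iSup_of_le hξ (le_iSup_of_le hξ1 le_rfl))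
  exact (lintegral_mono_ae (ae_restrict_of_ae hae)).trans
    (lintegral_liminf_le fun n => measurable_TV_subgraphFn hfin (hu n))

lemma liminf_add_liminf_le (u v : ℕ → ENNReal) :
    liminf u atTop + liminf v atTop ≤ liminf (fun n => u n + v n) atTop := by
  have hmono : ∀ w : ℕ → ENNReal, Monotone fun n => ⨅ i ≥ n, w i := fun w a b hab =>
    le_iInf₂ fun i hi => iInf₂_le i (hab.trans hi)
  simp only [liminf_eq_iSup_iInf_of_nat]
  rw [ENNReal.iSup_add_iSup_of_monotone (hmono u) (hmono v)]
  exact iSup_mono fun n => le_iInf₂ fun i hi => add_le_add (iInf₂_le i hi) (iInf₂_le i hi)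

lemma extIntegral_map {α β : Type*} [MeasurableSpace α] [MeasurableSpace β] {μ : Measure α}
    {F : α → β} (hF : Measurable F) {h : β → ℝ} (hh : AEMeasurable h (μ.map F)) :
    extIntegral (μ.map F) h = extIntegral μ (fun x => h (F x)) := by
  rw [extIntegral, extIntegral, lintegral_map' hh.ennreal_ofReal hF.aemeasurable,
    lintegral_map' (f := fun x => ENNReal.ofReal (-h x)) hh.neg.ennreal_ofReal hF.aemeasurable]

lemma extIntegral_eq_integral {α : Type*} [MeasurableSpace α] {μ : Measure α} {h : α → ℝ}
    (hh : Integrable h μ) : extIntegral μ h = ((∫ x, h x ∂μ : ℝ) : EReal) := by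
  rw [extIntegral_eq_lintegral_sub_add hh.aemeasurable hh (Eventually.of_forall fun _ => le_rfl)]
  simp

/-- The normalised image of Lebesgue measure on `Ω` under `u`. -/
noncomputable def valueDistribution (Ω : Set Plane) (u : Plane → ℝ) : Measure ℝ :=
  (volume Ω)⁻¹ • (volume.restrict Ω).map u

/-! ### The energy as a functional of the underlying function -/

section Energy

variable {Ω : Set Plane} {u : Plane → ℝ}

lemma isProbabilityMeasure_valueDistribution (h0 : volume Ω ≠ 0) (hfin : volume Ω ≠ ⊤)
    (hu : Measurable u) : IsProbabilityMeasure (valueDistribution Ω u) := by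
  refine ⟨?_⟩
  rw [valueDistribution, Measure.smul_apply, Measure.map_apply hu MeasurableSet.univ, preimage_univ,
    Measure.restrict_apply_univ, smul_eq_mul, ENNReal.inv_mul_cancel h0 hfin]

lemma valueDistribution_compl (hu : Measurable u) (hu01 : ∀ x, u x ∈ Icc (0 : ℝ) 1) :
    valueDistribution Ω u (Icc (0 : ℝ) 1)ᶜ = 0 := by
  rw [valueDistribution, Measure.smul_apply, Measure.map_apply hu measurableSet_Icc.compl]
  have : u ⁻¹' (Icc (0 : ℝ) 1)ᶜ = ∅ := by
    ext x
    simpa using hu01 x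
  rw [this]
  simp

lemma integral_valueDistribution (hu : Measurable u) {ψ : ℝ → ℝ} (hψ : Continuous ψ) :
    ∫ t, ψ t ∂(valueDistribution Ω u) = (volume Ω)⁻¹.toReal * ∫ x in Ω, ψ (u x) := by
  rw [valueDistribution, integral_smul_measure,
    integral_map hu.aemeasurable hψ.aestronglyMeasurable, smul_eq_mul]

lemma integrable_of_continuous_of_Icc {μ : Measure ℝ} [IsFiniteMeasure μ]
    (hμ : μ (Icc (0 : ℝ) 1)ᶜ = 0) {ψ : ℝ → ℝ} (hψ : Continuous ψ) : Integrable ψ μ := by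
  have h := hψ.continuousOn.integrableOn_compact (μ := μ) (isCompact_Icc (a := (0 : ℝ)) (b := 1))
  rwa [IntegrableOn, Measure.restrict_eq_self_of_ae_mem] at h
  filter_upwards [compl_mem_ae_iff.2 hμ] with t ht
  simpa using ht

/-- Dominated convergence; continuity of `ψ` is essential, which is why the limit is taken with
continuous potentials. -/
lemma tendsto_integral_valueDistribution (hfin : volume Ω ≠ ⊤) {v : ℕ → Plane → ℝ}
    (hv : ∀ n, Measurable (v n)) (hv01 : ∀ n x, v n x ∈ Icc (0 : ℝ) 1) (hu : Measurable u)
    (hlim : ∀ᵐ x ∂(volume.restrict Ω), Tendsto (fun n => v n x) atTop (𝓝 (u x)))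
    {ψ : ℝ → ℝ} (hψ : Continuous ψ) :
    Tendsto (fun n => ∫ t, ψ t ∂(valueDistribution Ω (v n))) atTop
      (𝓝 (∫ t, ψ t ∂(valueDistribution Ω u))) := by
  have : IsFiniteMeasure (volume.restrict Ω) := isFiniteMeasure_restrict.2 hfin
  simp only [integral_valueDistribution (hv _) hψ, integral_valueDistribution hu hψ]
  refine Tendsto.const_mul _ ?_
  obtain ⟨C, hC⟩ := (isCompact_Icc (a := (0 : ℝ)) (b := 1)).exists_bound_of_continuousOn
    hψ.continuousOn
  refine tendsto_integral_of_dominated_convergence (fun _ => C) (fun n => ?_)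
    (integrable_const C) (fun n => Eventually.of_forall fun x => hC _ (hv01 n x)) ?_
  · exact (hψ.measurable.comp (hv n)).aestronglyMeasurable
  · filter_upwards [hlim] with x hx
    exact (hψ.tendsto _).comp hx

lemma graphMeasure_restrict (hΩ : IsOpen Ω) (hu : Measurable u)
    (hu01 : ∀ x, u x ∈ Icc (0 : ℝ) 1) :
    (graphMeasure Ω u).restrict (Ω ×ˢ Icc (0 : ℝ) 1) = graphMeasure Ω u := by
  refine Measure.restrict_eq_self_of_ae_mem ?_
  have hmap : Measurable fun x : Plane => (x, u x) := measurable_id.prodMk hu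
  rw [graphMeasure, ae_map_iff (p := fun q => q ∈ Ω ×ˢ Icc (0 : ℝ) 1) hmap.aemeasurable
    (hΩ.measurableSet.prod measurableSet_Icc)]
  filter_upwards [ae_restrict_mem hΩ.measurableSet] with x hx
  exact ⟨hx, hu01 x⟩

lemma histogram_eq (hΩ : IsOpen Ω) (hfin : volume Ω ≠ ⊤) (hu : Measurable u)
    (hu01 : ∀ x, u x ∈ Icc (0 : ℝ) 1) {φ : Plane × ℝ → ℝ}
    (hφ : φ =ᵐ[volume.restrict (Ω ×ˢ (univ : Set ℝ))] subgraphFn u) :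
    histogram Ω φ = valueDistribution Ω u := by
  have hmap : Measurable fun x : Plane => (x, u x) := measurable_id.prodMk hu
  rw [histogram, negDerivGamma_eq hΩ hfin hu hφ, graphMeasure_restrict hΩ hu hu01, graphMeasure,
    Measure.map_map measurable_snd hmap]
  rfl

lemma aemeasurable_graphMeasure (hΩ : IsOpen Ω) (hu : Measurable u)
    (hu01 : ∀ x, u x ∈ Icc (0 : ℝ) 1) {f : ℝ → Plane → ℝ}
    (hf : ContinuousOn (fun q : ℝ × Plane => f q.1 q.2) (Icc (0 : ℝ) 1 ×ˢ Ω)) :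
    AEMeasurable (fun p : Plane × ℝ => f p.2 p.1) (graphMeasure Ω u) := by
  rw [← graphMeasure_restrict hΩ hu hu01]
  refine ContinuousOn.aemeasurable ?_ (hΩ.measurableSet.prod measurableSet_Icc)
  exact hf.comp continuous_swap.continuousOn fun p hp => ⟨hp.2, hp.1⟩

lemma aemeasurable_comp_graph (hΩ : IsOpen Ω) (hu : Measurable u)
    (hu01 : ∀ x, u x ∈ Icc (0 : ℝ) 1) {f : ℝ → Plane → ℝ}
    (hf : ContinuousOn (fun q : ℝ × Plane => f q.1 q.2) (Icc (0 : ℝ) 1 ×ˢ Ω)) :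
    AEMeasurable (fun x => f (u x) x) (volume.restrict Ω) :=
  (aemeasurable_graphMeasure hΩ hu hu01 hf).comp_measurable (measurable_id.prodMk hu)

/-- The energy of a lifted function in terms of the function it lifts. -/
lemma liftedEnergy_eq (hΩ : IsOpen Ω) (hfin : volume Ω ≠ ⊤) (hu : Measurable u)
    (hu01 : ∀ x, u x ∈ Icc (0 : ℝ) 1) {φ : Plane × ℝ → ℝ}
    (hφ : φ =ᵐ[volume.restrict (Ω ×ˢ (univ : Set ℝ))] subgraphFn u)
    {f : ℝ → Plane → ℝ}
    (hf : ContinuousOn (fun q : ℝ × Plane => f q.1 q.2) (Icc (0 : ℝ) 1 ×ˢ Ω))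
    {g : Plane → ℝ} (hg : IntegrableOn g Ω)
    (hgf : ∀ γ ∈ Icc (0 : ℝ) 1, ∀ x ∈ Ω, g x ≤ f γ x)
    {lam : ℝ} (hlam : 0 ≤ lam) (nu : ℝ) (μ₀ : Measure ℝ) (ψ ψ' : ℝ → ℝ) :
    liftedEnergy Ω f lam nu μ₀ φ ψ ψ' =
      (((∫⁻ x in Ω, ENNReal.ofReal (f (u x) x - g x)) + ENNReal.ofReal lam *
        ∫⁻ γ in Icc (0 : ℝ) 1, TV Ω (fun x => subgraphFn u (x, γ)) : ENNReal) : EReal)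
      + ((∫ x in Ω, g x : ℝ) : EReal)
      + (nu : EReal) * (extIntegral (valueDistribution Ω u) ψ
        + extIntegral μ₀ (fun γ => -ψ' γ)) := by
  have hmap : Measurable fun x : Plane => (x, u x) := measurable_id.prodMk hu
  have h1 : extIntegral (graphMeasure Ω u) (fun p => f p.2 p.1)
      = ((∫⁻ x in Ω, ENNReal.ofReal (f (u x) x - g x) : ENNReal) : EReal)
        + ((∫ x in Ω, g x : ℝ) : EReal) := by
    have h2 : extIntegral (graphMeasure Ω u) (fun p => f p.2 p.1)
        = extIntegral (volume.restrict Ω) (fun x => f (u x) x) :=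
      extIntegral_map hmap (aemeasurable_graphMeasure hΩ hu hu01 hf)
    rw [h2]
    refine extIntegral_eq_lintegral_sub_add (aemeasurable_comp_graph hΩ hu hu01 hf) hg ?_
    filter_upwards [ae_restrict_mem hΩ.measurableSet] with x hx
    exact hgf _ (hu01 x) x hx
  rw [liftedEnergy, negDerivGamma_eq hΩ hfin hu hφ, graphMeasure_restrict hΩ hu hu01,
    histogram_eq hΩ hfin hu hu01 hφ, lintegral_TV_congr hφ, h1, EReal.coe_ennreal_add,
    EReal.coe_ennreal_mul, EReal.coe_ennreal_ofReal, max_eq_left hlam]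
  congr 1
  exact add_right_comm _ _ _

lemma lintegral_sub_le_liminf (hΩ : IsOpen Ω) {v : ℕ → Plane → ℝ}
    (hv : ∀ n, Measurable (v n)) (hv01 : ∀ n x, v n x ∈ Icc (0 : ℝ) 1)
    (hu01 : ∀ x, u x ∈ Icc (0 : ℝ) 1)
    (hlim : ∀ᵐ x ∂(volume.restrict Ω), Tendsto (fun n => v n x) atTop (𝓝 (u x)))
    {f : ℝ → Plane → ℝ}
    (hf : ContinuousOn (fun q : ℝ × Plane => f q.1 q.2) (Icc (0 : ℝ) 1 ×ˢ Ω))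
    {g : Plane → ℝ} (hg : IntegrableOn g Ω) :
    ∫⁻ x in Ω, ENNReal.ofReal (f (u x) x - g x) ≤
      liminf (fun n => ∫⁻ x in Ω, ENNReal.ofReal (f (v n x) x - g x)) atTop := by
  refine le_trans (lintegral_mono_ae ?_) (lintegral_liminf_le' fun n =>
    ((aemeasurable_comp_graph hΩ (hv n) (hv01 n) hf).sub hg.aemeasurable).ennreal_ofReal)
  filter_upwards [hlim, ae_restrict_mem hΩ.measurableSet] with x hx hxΩ
  have h1 : Tendsto (fun n => (v n x, x)) atTop (𝓝[Icc (0 : ℝ) 1 ×ˢ Ω] (u x, x)) :=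
    tendsto_nhdsWithin_iff.2 ⟨hx.prodMk_nhds tendsto_const_nhds,
      Eventually.of_forall fun n => ⟨hv01 n x, hxΩ⟩⟩
  have h2 : Tendsto (fun n => f (v n x) x) atTop (𝓝 (f (u x) x)) :=
    (hf (u x, x) ⟨hu01 x, hxΩ⟩).tendsto.comp h1
  exact (ENNReal.tendsto_ofReal (h2.sub_const (g x))).liminf_eq.ge

end Energy

/-- A competitor must exist for minimising sequences, and for the case of infinite infimum; every
slice of this one at `γ ≥ 0` vanishes. -/
lemma isLifted_subgraphFn_zero {Ω : Set Plane} (hΩ : IsOpen Ω) (hfin : volume Ω ≠ ⊤) :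
    IsLifted Ω (subgraphFn fun _ => 0) := by
  refine isLifted_subgraphFn hΩ hfin measurable_const (fun x => by simp) ?_
  rw [setLIntegral_congr_fun (g := fun _ => 0) measurableSet_Icc]
  · simp
  · intro γ hγ
    have : ∀ x : Plane, subgraphFn (fun _ => 0) (x, γ) = 0 := fun x => subgraphFn_of_le hγ.1
    simp [TV, this]

end LiftedWasserstein

open LiftedWasserstein

/-! ### The direct method -/

theorem mainTheorem1
    (Ω : Set LiftedWasserstein.Plane) (hΩ_open : IsOpen Ω) (hΩ_bdd : Bornology.IsBounded Ω)
    (hΩ_ne : Ω.Nonempty)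
    (f : ℝ → LiftedWasserstein.Plane → ℝ)
    (hf : ContinuousOn (fun q : ℝ × LiftedWasserstein.Plane => f q.1 q.2) (Icc (0 : ℝ) 1 ×ˢ Ω))
    (hf_below : ∃ g : LiftedWasserstein.Plane → ℝ, IntegrableOn g Ω ∧
      ∀ γ ∈ Icc (0 : ℝ) 1, ∀ x ∈ Ω, g x ≤ f γ x)
    (c : ℝ → ℝ → ℝ)
    (hc : LowerSemicontinuousOn (fun q : ℝ × ℝ => c q.1 q.2) (Icc (0 : ℝ) 1 ×ˢ Icc (0 : ℝ) 1))
    (hc_below : ∃ a b : ℝ → ℝ,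
      UpperSemicontinuousOn a (Icc 0 1) ∧ IntegrableOn a (Icc 0 1) ∧
      UpperSemicontinuousOn b (Icc 0 1) ∧ IntegrableOn b (Icc 0 1) ∧
      ∀ γ₁ ∈ Icc (0 : ℝ) 1, ∀ γ₂ ∈ Icc (0 : ℝ) 1, a γ₁ + b γ₂ ≤ c γ₁ γ₂)
    (μ₀ : Measure ℝ) [IsProbabilityMeasure μ₀] (hμ₀ : μ₀ (Icc (0 : ℝ) 1)ᶜ = 0)
    (lam nu : ℝ) (hlam : 0 < lam) (hnu : 0 < nu) :
    ∃ φ : LiftedWasserstein.Plane × ℝ → ℝ, LiftedWasserstein.IsLifted Ω φ ∧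
      IsMinOn
        (fun φ' => ⨆ p ∈ LiftedWasserstein.dualSet c,
          LiftedWasserstein.liftedEnergy Ω f lam nu μ₀ φ' p.1 p.2)
        {φ' | LiftedWasserstein.IsLifted Ω φ'} φ := by
  obtain ⟨g, hg, hgf⟩ := hf_below
  have hfin : volume Ω ≠ ⊤ := hΩ_bdd.measure_lt_top.ne
  have hpos : volume Ω ≠ 0 := (hΩ_open.measure_pos volume hΩ_ne).ne'
  let J : (Plane × ℝ → ℝ) → EReal := fun φ => ⨆ p ∈ dualSet c, liftedEnergy Ω f lam nu μ₀ φ p.1 p.2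
  let A : (Plane → ℝ) → ENNReal := fun u =>
    (∫⁻ x in Ω, ENNReal.ofReal (f (u x) x - g x)) + ENNReal.ofReal lam *
      ∫⁻ γ in Icc (0 : ℝ) 1, TV Ω (fun x => subgraphFn u (x, γ))
  let r : ℝ := ∫ x in Ω, g x
  let IsPot : (ℝ → ℝ) → (ℝ → ℝ) → Prop := fun ψ ψ' => Continuous ψ ∧ Continuous ψ' ∧
    ∀ γ₁ ∈ Icc (0 : ℝ) 1, ∀ γ₂ ∈ Icc (0 : ℝ) 1, ψ γ₁ - ψ' γ₂ ≤ c γ₁ γ₂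
  let b : (Plane → ℝ) → (ℝ → ℝ) → (ℝ → ℝ) → ℝ := fun u ψ ψ' =>
    ∫ t, ψ t ∂(valueDistribution Ω u) - ∫ t, ψ' t ∂μ₀
  -- the energy dominates its value at continuous potentials
  have hlow : ∀ φ u, Measurable u → (∀ x, u x ∈ Icc (0 : ℝ) 1) →
      φ =ᵐ[volume.restrict (Ω ×ˢ (univ : Set ℝ))] subgraphFn u → ∀ ψ ψ', IsPot ψ ψ' →
      ((A u : ENNReal) : EReal) + ((r + nu * b u ψ ψ' : ℝ) : EReal) ≤ J φ := by
    rintro φ u hu hu01 hφ ψ ψ' ⟨hψ, hψ', hle⟩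
    have := isProbabilityMeasure_valueDistribution hpos hfin hu
    have hmem : (ψ, ψ') ∈ dualSet c :=
      ⟨hψ.measurable, hψ'.measurable, hψ.integrableOn_Icc, hψ'.integrableOn_Icc, hle⟩
    refine le_trans (le_of_eq ?_) (le_iSup₂_of_le (ψ, ψ') hmem le_rfl)
    rw [liftedEnergy_eq hΩ_open hfin hu hu01 hφ hf hg hgf hlam.le, extIntegral_eq_integral
      (integrable_of_continuous_of_Icc (valueDistribution_compl hu hu01) hψ),
      extIntegral_eq_integral (h := fun t => -ψ' t)
        (integrable_of_continuous_of_Icc hμ₀ hψ'.neg), integral_neg,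
      EReal.coe_add, ← add_assoc]
    congr 1
  -- The minimum of `c` makes `(m, 0)` an admissible continuous pair. It bounds the energy from
  -- below and later yields the variation bound.
  obtain ⟨m, hm⟩ : ∃ m, ∀ γ₁ ∈ Icc (0 : ℝ) 1, ∀ γ₂ ∈ Icc (0 : ℝ) 1, m ≤ c γ₁ γ₂ := by
    obtain ⟨z, -, hz⟩ := LowerSemicontinuousOn.exists_isMinOn
      (s := Icc (0 : ℝ) 1 ×ˢ Icc (0 : ℝ) 1) ⟨(0, 0), by simp⟩
      (isCompact_Icc.prod isCompact_Icc) hc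
    exact ⟨_, fun γ₁ h₁ γ₂ h₂ => hz (show (γ₁, γ₂) ∈ _ from ⟨h₁, h₂⟩)⟩
  have hpotm : IsPot (fun _ => m) (fun _ => 0) :=
    ⟨continuous_const, continuous_const, fun s hs t ht => by simpa using hm s hs t ht⟩
  have hbm : ∀ u, Measurable u → b u (fun _ => m) (fun _ => 0) = m := by
    intro u hu
    have := isProbabilityMeasure_valueDistribution hpos hfin hu
    simp [b]
  have hφ₀ := isLifted_subgraphFn_zero hΩ_open hfin
  let S : Set EReal := J '' {φ | IsLifted Ω φ}
  have hSle : ∀ φ, IsLifted Ω φ → sInf S ≤ J φ := fun φ hφ => sInf_le ⟨φ, hφ, rfl⟩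
  -- If every competitor has infinite energy, any of them is a minimiser.
  rcases eq_or_ne (sInf S) ⊤ with htop | htop
  · refine ⟨_, hφ₀, fun φ' hφ' => ?_⟩
    have : J φ' = ⊤ := top_le_iff.1 (htop ▸ hSle φ' hφ')
    change J _ ≤ J φ'
    rw [this]
    exact le_top
  have hbot : sInf S ≠ ⊥ := by
    have : ((r + nu * m : ℝ) : EReal) ≤ sInf S := by
      refine le_sInf ?_
      rintro _ ⟨φ, hφ, rfl⟩
      obtain ⟨u, hu, hu01, hφu⟩ := hφ.exists_subgraph hΩ_open
      have := hlow φ u hu hu01 hφu _ _ hpotm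
      rw [hbm u hu] at this
      exact le_trans (le_add_of_nonneg_left (EReal.coe_ennreal_nonneg _)) this
    intro h
    rw [h] at this
    exact EReal.coe_ne_bot _ (le_bot_iff.1 this)
  obtain ⟨i, hi⟩ : ∃ i : ℝ, sInf S = (i : EReal) := ⟨_, (EReal.coe_toReal htop hbot).symm⟩
  obtain ⟨s, -, hslim, hsS⟩ := exists_seq_tendsto_sInf (S := S) ⟨_, _, hφ₀, rfl⟩ (OrderBot.bddBelow S)
  obtain ⟨N, hN⟩ := eventually_atTop.1 (hslim.eventually_lt_const (lt_top_iff_ne_top.2 htop))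
  -- The shift by `N` discards the terms that may be `⊤`, so that the remaining energies are real.
  have hchoose : ∀ n, ∃ (j : ℝ) (u : Plane → ℝ), s (n + N) = j ∧ Measurable u ∧
      (∀ x, u x ∈ Icc (0 : ℝ) 1) ∧ ∀ ψ ψ', IsPot ψ ψ' →
      ((A u : ENNReal) : EReal) + ((r + nu * b u ψ ψ' : ℝ) : EReal) ≤ j := by
    intro n
    obtain ⟨φ, hφ, hφs⟩ := hsS (n + N)
    obtain ⟨u, hu, hu01, hφu⟩ := IsLifted.exists_subgraph hΩ_open hφ
    have h1 : s (n + N) ≠ ⊤ := (hN _ (Nat.le_add_left N n)).ne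
    have h2 : s (n + N) ≠ ⊥ := fun h => hbot (le_bot_iff.1 (h ▸ sInf_le (hsS (n + N))))
    refine ⟨(s (n + N)).toReal, u, (EReal.coe_toReal h1 h2).symm, hu, hu01, fun ψ ψ' hp => ?_⟩
    rw [EReal.coe_toReal h1 h2, ← hφs]
    exact hlow φ u hu hu01 hφu ψ ψ' hp
  choose j u hj hu hu01 hE using hchoose
  have hjlim : Tendsto j atTop (𝓝 i) := by
    rw [← EReal.tendsto_coe, ← hi]
    exact (hslim.comp (tendsto_add_atTop_nat N)).congr hj
  -- the same bounds in `ℝ` and `[0, ∞]`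
  have hA : ∀ n ψ ψ', IsPot ψ ψ' → 0 ≤ j n - r - nu * b (u n) ψ ψ' ∧
      A (u n) ≤ ENNReal.ofReal (j n - r - nu * b (u n) ψ ψ') := by
    intro n ψ ψ' hp
    have h := hE n ψ ψ' hp
    have hAtop : A (u n) ≠ ⊤ := by
      intro h'
      rw [h', EReal.coe_ennreal_top, EReal.top_add_coe] at h
      exact EReal.coe_ne_top _ (top_le_iff.1 h)
    rw [← EReal.coe_ennreal_toReal hAtop] at h
    have h' : (A (u n)).toReal + (r + nu * b (u n) ψ ψ') ≤ j n := by exact_mod_cast h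
    have h0 : 0 ≤ (A (u n)).toReal := ENNReal.toReal_nonneg
    exact ⟨by linarith, (ENNReal.le_ofReal_iff_toReal_le hAtop (by linarith)).2 (by linarith)⟩
  obtain ⟨C, hC⟩ := hjlim.bddAbove_range
  have hjC : ∀ n, j n ≤ C := fun n => hC ⟨n, rfl⟩
  let M : ℝ := (C - r - nu * m) / lam
  have hT : ∀ n, ∫⁻ γ in Icc (0 : ℝ) 1, TV Ω (fun x => subgraphFn (u n) (x, γ)) ≤
      ENNReal.ofReal M := by
    intro n
    obtain ⟨-, h⟩ := hA n _ _ hpotm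
    rw [hbm _ (hu n)] at h
    have h1 := (le_add_self.trans h).trans
      (ENNReal.ofReal_le_ofReal (show j n - r - nu * m ≤ C - r - nu * m by linarith [hjC n]))
    rw [ENNReal.ofReal_div_of_pos hlam, ENNReal.le_div_iff_mul_le (Or.inl (by simpa using hlam))
      (Or.inl ENNReal.ofReal_ne_top), mul_comm]
    exact h1
  have hM0 : 0 ≤ M := by
    obtain ⟨h, -⟩ := hA 0 _ _ hpotm
    rw [hbm _ (hu 0)] at h
    exact div_nonneg (by linarith [hjC 0]) hlam.le
  obtain ⟨w, k, hk, hw, hw01, hlim⟩ := exists_subseq_tendsto_ae hΩ_open hfin hu hu01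
    fun n ξ hξ hξ1 => setIntegral_mul_div_le (hu n) (hu01 n) hM0 (hT n) hξ hξ1
  -- The limit is taken with the pair fixed: its transport term converges, and `A` is lower
  -- semicontinuous.
  have hwA : ∀ ψ ψ', IsPot ψ ψ' → 0 ≤ i - r - nu * b w ψ ψ' ∧
      A w ≤ ENNReal.ofReal (i - r - nu * b w ψ ψ') := by
    intro ψ ψ' hp
    have hblim : Tendsto (fun n => j (k n) - r - nu * b (u (k n)) ψ ψ') atTop
        (𝓝 (i - r - nu * b w ψ ψ')) := by
      refine ((hjlim.comp hk.tendsto_atTop).sub_const r).sub (Tendsto.const_mul nu ?_)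
      exact (tendsto_integral_valueDistribution hfin (fun n => hu (k n)) (fun n => hu01 (k n)) hw
        hlim hp.1).sub_const _
    refine ⟨ge_of_tendsto' hblim fun n => (hA (k n) ψ ψ' hp).1, ?_⟩
    have h1 := lintegral_sub_le_liminf hΩ_open (fun n => hu (k n)) (fun n => hu01 (k n)) hw01
      hlim hf hg
    have h2 := lintegral_TV_le_liminf hfin (fun n => hu (k n)) hw hlim
    calc A w ≤ liminf (fun n => ∫⁻ x in Ω, ENNReal.ofReal (f (u (k n) x) x - g x)) atTop
          + ENNReal.ofReal lam * liminf (fun n => ∫⁻ γ in Icc (0 : ℝ) 1,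
            TV Ω (fun x => subgraphFn (u (k n)) (x, γ))) atTop :=
          add_le_add h1 (mul_le_mul_right h2 _)
      _ ≤ liminf (fun n => A (u (k n))) atTop := by
          rw [← ENNReal.liminf_const_mul_of_ne_top ENNReal.ofReal_ne_top]
          exact liminf_add_liminf_le _ _
      _ ≤ liminf (fun n => ENNReal.ofReal (j (k n) - r - nu * b (u (k n)) ψ ψ')) atTop :=
          liminf_le_liminf (Eventually.of_forall fun n => (hA (k n) ψ ψ' hp).2)
      _ = ENNReal.ofReal (i - r - nu * b w ψ ψ') := (ENNReal.tendsto_ofReal hblim).liminf_eq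
  have hAw : A w ≠ ⊤ := ne_top_of_le_ne_top ENNReal.ofReal_ne_top (hwA _ _ hpotm).2
  have hTw : ∫⁻ γ in Icc (0 : ℝ) 1, TV Ω (fun x => subgraphFn w (x, γ)) ≠ ⊤ := by
    intro h
    refine hAw ?_
    simp only [A, h]
    rw [ENNReal.mul_top (by simpa using hlam), add_top]
  refine ⟨subgraphFn w, isLifted_subgraphFn hΩ_open hfin hw hw01 hTw, fun φ' hφ' => ?_⟩
  refine le_trans ?_ (hSle φ' hφ')
  rw [hi]
  -- This is the bound that `hwA` gives for every continuous pair; with it `A w + r + nu * K` is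
  -- exactly the infimum `i`.
  let K : ℝ := (i - r - (A w).toReal) / nu
  have := isProbabilityMeasure_valueDistribution hpos hfin hw
  refine iSup₂_le fun p hp => ?_
  obtain ⟨hp1, hp2, -, -, hpc⟩ := hp
  have hdual := extIntegral_dual_le hc (valueDistribution_compl (Ω := Ω) hw hw01) hμ₀ (K := K)
    (fun ψ ψ' hψ hψ' hle => by
      obtain ⟨h0, h⟩ := hwA ψ ψ' ⟨hψ, hψ', hle⟩
      have := (ENNReal.le_ofReal_iff_toReal_le hAw h0).1 h
      rw [le_div_iff₀ hnu]
      change b w ψ ψ' * nu ≤ _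
      linarith) hp1 hp2 hpc
  rw [liftedEnergy_eq hΩ_open hfin hw hw01 (ae_eq_refl _) hf hg hgf hlam.le]
  change ((A w : ENNReal) : EReal) + ((r : ℝ) : EReal) + _ ≤ _
  have hmul := mul_le_mul_of_nonneg_left hdual (EReal.coe_nonneg.2 hnu.le)
  refine (add_le_add_right hmul _).trans ?_
  rw [← EReal.coe_ennreal_toReal hAw]
  norm_cast
  simp only [K]
  rw [mul_div_cancel₀ _ hnu.ne']
  linarith
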